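/- All graphs are finite and simple. A boundaried graph $G_B$ is a graph $G$ together with a set $B\subseteq V(G)$. For boundaried graphs $G_B$ and $H_B$ with the same boundary $B$, let $G_B\oplus H_B$ be the simple graph obtained from the disjoint union of $G$ and $H$ by identifying the two copies of each vertex of $B$. For a graph $Q$ let $\mathrm{OPT}_{\mathrm{LC}}(Q)$ be the maximum length of a cycle in $Q$, and $-\infty$ if $Q$ has no cycle. A vertex cover of $G$ is a set $X\subseteq V(G)$ such that $G-X$ has no edges. **Theorem.** Long Cycle parameterized by the size of a given vertex cover admits a polynomial boundaried kernelization with $\mathcal{O}((|B|+k)^2)$ vertices. That is, there are a constant $c$, a polynomial $f$ and a polynomial-time algorithm that, given a boundaried graph $G_B$ and a vertex cover $X$ of $G$ of size $k=|X|$, outputs a boundaried graph $G'_B$ with the same boundary $B\subseteq V(G')$, a vertex cover $X'$ of $G'$ and an integer $\Delta$ such that 1. $|V(G')|\le c\,(|B|+k)^2$, and both $|V(G')|+|E(G')|$ and $|X'|$ are at most $f(|B|+k)$; 2. for every boundaried graph $H_B$, $\mathrm{OPT}_{\mathrm{LC}}(G_B\oplus H_B)=\mathrm{OPT}_{\mathrm{LC}}(G'_B\oplus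 H_B)+\Delta$. -/

import Mathlib

/-! ### Finite graphs, gluing -/

/-- A finite simple graph whose vertices are elements of `α`. -/
structure FinGraph (α : Type) where
  verts : Finset α
  graph : SimpleGraph α
  mem_of_adj : ∀ u v, graph.Adj u v → u ∈ verts

namespace FinGraph

/-- Number of vertices plus number of edges. -/
noncomputable def size {α : Type} (G : FinGraph α) : ℕ :=
  G.verts.card + G.graph.edgeSet.ncard

/-- `S` is a set of vertices of `G` such that `G - S` has no edges. -/
def IsVertexCover {α : Type} (G : FinGraph α) (S : Finset α) : Prop :=
  S ⊆ G.verts ∧ G.graph.IsVertexCover (S : Set α)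

/-- The optimum value of Long Cycle: the largest length of a cycle (closed walk of length at
least three without repeated vertices), and `-∞` if there is no cycle. -/
noncomputable def longCycleOpt {α : Type} (G : FinGraph α) : EReal :=
  ⨆ (v : α) (c : G.graph.Walk v v) (_ : c.IsCycle), ((c.length : ℝ) : EReal)

/-- Position of a vertex of the second graph in the glued graph: vertices in the common boundary
`D` are identified with the vertices of the first graph, the others are new. -/
def place (D : Finset ℕ) (w : ℕ) : ℕ ⊕ ℕ :=
  if w ∈ D then Sum.inl w else Sum.inr w

theorem place_injective (D : Finset ℕ) : Function.Injective (place D) := by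
  intro a b h
  unfold place at h
  split_ifs at h <;> simp_all

/-- Gluing `G_B ⊕ H_C`: the disjoint union of `G` and `H` with the vertices of `B ∩ C`
identified, as a simple graph. Vertices of `H` outside `B ∩ C` are kept apart from those of `G`
also if they have the same name. -/
noncomputable def glue (G : FinGraph ℕ) (B : Finset ℕ) (H : FinGraph ℕ) (C : Finset ℕ) :
    FinGraph (ℕ ⊕ ℕ) where
  verts := G.verts.image Sum.inl ∪ H.verts.image (place (B ∩ C))
  graph :=
    { Adj := fun x y =>
        (∃ u v, G.graph.Adj u v ∧ x = Sum.inl u ∧ y = Sum.inl v) ∨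
        (∃ u v, H.graph.Adj u v ∧ x = place (B ∩ C) u ∧ y = place (B ∩ C) v)
      symm := by
        constructor
        rintro x y (⟨u, v, h, rfl, rfl⟩ | ⟨u, v, h, rfl, rfl⟩)
        · exact Or.inl ⟨v, u, h.symm, rfl, rfl⟩
        · exact Or.inr ⟨v, u, h.symm, rfl, rfl⟩
      loopless := by
        constructor
        rintro x (⟨u, v, h, rfl, h2⟩ | ⟨u, v, h, rfl, h2⟩)
        · exact h.ne (Sum.inl.inj h2)
        · exact h.ne (place_injective _ h2) }
  mem_of_adj := by
    rintro x y (⟨u, v, h, rfl, rfl⟩ | ⟨u, v, h, rfl, rfl⟩)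
    · exact Finset.mem_union_left _ (Finset.mem_image_of_mem _ (G.mem_of_adj u v h))
    · exact Finset.mem_union_right _ (Finset.mem_image_of_mem _ (H.mem_of_adj u v h))

/-- `G_B` and `G'_B` are gluing equivalent with offset `Δ` for the optimization problem with
optimum value `opt`. -/
def GluingEquiv (opt : FinGraph (ℕ ⊕ ℕ) → EReal) (B : Finset ℕ) (G G' : FinGraph ℕ) (Δ : ℤ) :
    Prop :=
  ∀ H : FinGraph ℕ, B ⊆ H.verts →
    opt (glue G B H B) = opt (glue G' B H B) + (((Δ : ℤ) : ℝ) : EReal)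

end FinGraph

/-! ### Machine model

Programs of a random access machine with addition and truncated subtraction of natural numbers
(no multiplication). A program mentions finitely many registers and finitely many arrays; array
cells are addressed indirectly through registers. Every instruction and every test takes one time
step. As the bit length of the largest number stored grows by at most one per step (apart from the
fixed constants of the program), polynomial time in the bit length of the input is the same as on
Turing machines. -/

namespace RAM

/-- Memory: registers `reg r`, and arrays `arr a` with cells `arr a i`. -/
structure State where
  reg : ℕ → ℕ
  arr : ℕ → ℕ → ℕ

namespace State

def setReg (s : State) (r x : ℕ) : State :=
  { s with reg := Function.update s.reg r x }

def setCell (s : State) (a i x : ℕ) : State :=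
  { s with arr := Function.update s.arr a (Function.update (s.arr a) i x) }

/-- The input word is in array `0`, its length in register `0`; all else is `0`. -/
def init (w : List ℕ) : State where
  reg := fun r => if r = 0 then w.length else 0
  arr := fun a i => if a = 0 then w.getD i 0 else 0

/-- The output word is in array `1`, its length in register `0`. -/
def output (s : State) : List ℕ :=
  (List.range (s.reg 0)).map (s.arr 1)

end State

/-- Programs; all arguments are fixed numbers: constants, indices of registers or of arrays. -/
inductive Program where
  /-- `reg r := c` -/
  | const (r c : ℕ)
  /-- `reg r := reg x + reg y` -/
  | add (r x y : ℕ)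
  /-- `reg r := reg x - reg y`, and `0` if this is negative -/
  | sub (r x y : ℕ)
  /-- `reg r := arr a (reg i)` -/
  | load (r a i : ℕ)
  /-- `arr a (reg i) := reg x` -/
  | store (a i x : ℕ)
  /-- sequential composition -/
  | seq (P Q : Program)
  /-- if `reg r ≠ 0` then `P` else `Q` -/
  | branch (r : ℕ) (P Q : Program)
  /-- while `reg r ≠ 0` do `P` -/
  | loop (r : ℕ) (P : Program)

/-- `Exec P s t s'`: started in state `s`, the program `P` halts after exactly `t` steps in state
`s'`. -/
inductive Exec : Program → State → ℕ → State → Prop where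
  | const (r c : ℕ) (s : State) : Exec (.const r c) s 1 (s.setReg r c)
  | add (r x y : ℕ) (s : State) : Exec (.add r x y) s 1 (s.setReg r (s.reg x + s.reg y))
  | sub (r x y : ℕ) (s : State) : Exec (.sub r x y) s 1 (s.setReg r (s.reg x - s.reg y))
  | load (r a i : ℕ) (s : State) : Exec (.load r a i) s 1 (s.setReg r (s.arr a (s.reg i)))
  | store (a i x : ℕ) (s : State) : Exec (.store a i x) s 1 (s.setCell a (s.reg i) (s.reg x))
  | seq {P Q : Program} {s s₁ s₂ : State} {t₁ t₂ : ℕ} :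
      Exec P s t₁ s₁ → Exec Q s₁ t₂ s₂ → Exec (.seq P Q) s (t₁ + t₂) s₂
  | branchTrue {r : ℕ} {P Q : Program} {s s₁ : State} {t : ℕ} :
      s.reg r ≠ 0 → Exec P s t s₁ → Exec (.branch r P Q) s (t + 1) s₁
  | branchFalse {r : ℕ} {P Q : Program} {s s₁ : State} {t : ℕ} :
      s.reg r = 0 → Exec Q s t s₁ → Exec (.branch r P Q) s (t + 1) s₁
  | loopStop {r : ℕ} {P : Program} {s : State} :
      s.reg r = 0 → Exec (.loop r P) s 1 s
  | loopStep {r : ℕ} {P : Program} {s s₁ s₂ : State} {t₁ t₂ : ℕ} :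
      s.reg r ≠ 0 → Exec P s t₁ s₁ → Exec (.loop r P) s₁ t₂ s₂ →
        Exec (.loop r P) s (t₁ + t₂ + 1) s₂

/-- Bit size of a word of natural numbers. -/
def wordSize (w : List ℕ) : ℕ :=
  (w.map fun x => Nat.size x + 1).sum

end RAM

/-! ### Encoding of instances, boundaried kernelizations -/

open Classical in
/-- The word describing a graph with vertex list `l` and two vertex sets `B`, `S`: the number of
vertices, their names, the indicator vectors of `B` and `S`, and the adjacency matrix. -/
noncomputable def encodeWith (l : List ℕ) (G : FinGraph ℕ) (B S : Finset ℕ) : List ℕ :=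
  l.length ::
    (l ++ l.map (fun v => if v ∈ B then 1 else 0) ++ l.map (fun v => if v ∈ S then 1 else 0) ++
      l.flatMap (fun u => l.map (fun v => if G.graph.Adj u v then 1 else 0)))

/-- `w` encodes the boundaried graph `G_B` together with the vertex set `S`, the vertices being
listed in some order. -/
def Encodes (w : List ℕ) (G : FinGraph ℕ) (B S : Finset ℕ) : Prop :=
  ∃ l : List ℕ, l.Nodup ∧ l.toFinset = G.verts ∧ w = encodeWith l G B S

/-- An integer as two natural numbers: a sign and the absolute value. -/
def encodeInt (Δ : ℤ) : List ℕ :=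
  [if Δ < 0 then 1 else 0, Δ.natAbs]

/-- `P` is a boundaried kernelization of size `f`, whose output graphs have at most `g` vertices
(as functions of boundary size plus parameter), for the graph optimization problem with optimum
value `opt`, parameterized by the size of a given solution (a vertex set with `feasible G S`):
in polynomial time, `P` maps each encoding of a boundaried graph `G_B` with solution `S` to an
encoding of an integer `Δ` and a boundaried graph `G'_B` with solution `S'`, such that `G_B` and
`G'_B` are gluing equivalent with offset `Δ`. -/
def IsBoundariedKernelization (opt : FinGraph (ℕ ⊕ ℕ) → EReal)
    (feasible : FinGraph ℕ → Finset ℕ → Prop) (f g : ℕ → ℕ) (P : RAM.Program) : Prop :=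
  ∃ p : Polynomial ℕ, ∀ (G : FinGraph ℕ) (B S : Finset ℕ), B ⊆ G.verts → feasible G S →
    ∀ w : List ℕ, Encodes w G B S →
      ∃ (t : ℕ) (s : RAM.State) (G' : FinGraph ℕ) (S' : Finset ℕ) (Δ : ℤ) (w' : List ℕ),
        RAM.Exec P (RAM.State.init w) t s ∧
        t ≤ p.eval (RAM.wordSize w) ∧
        s.output = encodeInt Δ ++ w' ∧
        Encodes w' G' B S' ∧
        B ⊆ G'.verts ∧
        feasible G' S' ∧
        G'.size ≤ f (B.card + S.card) ∧
        S'.card ≤ f (B.card + S.card) ∧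
        G'.verts.card ≤ g (B.card + S.card) ∧
        FinGraph.GluingEquiv opt B G G' Δ

/-! Let `R` be the set of vertices of `G` outside `B` and the cover `S`. Even after gluing, all
neighbors of `R` lie in `S`. Hence a vertex of `R` on a cycle merely connects its two cycle
neighbors in `S`, and any unused common neighbor of these in `R` does as well. The kernel is the
subgraph induced by `B`, `S` and at most one vertex of `R` for each ordered pair in `S × S`, with
offset `0`.

The vertices to keep are found by an auction. Labels on `R` start at `0`. An unmatched pair takes
over a common neighbor of least label, displaces its owner and raises the label by one, until an
unmatched pair sees only labels at least `L`, where `L > |S|`. Since labels never decrease, the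
label of a pair's partner exceeds that of no common neighbor by more than one. Exactly the vertices
with positive label are matched, and these are kept.

The exchange argument is `cycleGraph_isContained_of_labeling`. A cycle has at most `|S|` vertices in
`R`, so some label `j < L` does not occur on it. Replace each vertex of `R` with label below `j` by
the partner of the pair of its cycle neighbors. The new vertices have labels at most `j`, the
remaining ones in `R` have labels above `j`, and distinct pairs have distinct partners, so the
result is a cycle of the same length without vertices of label `0` in `R`.

A round of bids either finds a stable state or increases the sum of the labels, which is at most `n
* L` with `L = n + 1`; this is `round_sem`, and it bounds the number of rounds. The algorithm is
written in a language whose loops all have `n + b` rounds. Its compilation `Stmt.exec_compile`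
yields the polynomial running time, so that correctness (`auction_sem`, `emit_sem`, `main_sem`) only
concerns functions on arrays. -/

/-! ### A small imperative language and its compilation to the machine -/

namespace Imp

open RAM

/-- Memory of the language: a family of arrays. -/
abbrev Arrays := ℕ → ℕ → ℕ

/-- Overwrite one cell. -/
def Arrays.set (A : Arrays) (a i x : ℕ) : Arrays :=
  Function.update A a (Function.update (A a) i x)

/-- Expressions; `var k` is the variable of the loop at nesting depth `k`. -/
inductive Expr where
  | var (k : ℕ)
  | const (c : ℕ)
  | add (e f : Expr)
  | sub (e f : Expr)
  | load (a : ℕ) (e : Expr)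

namespace Expr

def eval (env : ℕ → ℕ) (A : Arrays) : Expr → ℕ
  | var k => env k
  | const c => c
  | add e f => e.eval env A + f.eval env A
  | sub e f => e.eval env A - f.eval env A
  | load a e => A a (e.eval env A)

/-- Only loop variables of depth less than `k` occur. -/
def Scoped (k : ℕ) : Expr → Prop
  | var j => j < k
  | const _ => True
  | add e f => e.Scoped k ∧ f.Scoped k
  | sub e f => e.Scoped k ∧ f.Scoped k
  | load _ e => e.Scoped k

/-- Evaluate into register `d`, using the registers from `d` on. -/
def compile : Expr → ℕ → Program
  | var k, d => .seq (.const d 0) (.add d d (3 * k))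
  | const c, d => .const d c
  | add e f, d => .seq (e.compile d) (.seq (f.compile (d + 1)) (.add d d (d + 1)))
  | sub e f, d => .seq (e.compile d) (.seq (f.compile (d + 1)) (.sub d d (d + 1)))
  | load a e, d => .seq (e.compile d) (.load d a d)

def time : Expr → ℕ
  | var _ => 2
  | const _ => 1
  | add e f => e.time + (f.time + 1)
  | sub e f => e.time + (f.time + 1)
  | load _ e => e.time + 1

/-- Preserving all registers below `d` makes the induction work: the value of a first operand in `d`
survives the evaluation of the second one into `d + 1`. -/
theorem exec_compile {env : ℕ → ℕ} {k : ℕ} (e : Expr) (d : ℕ) (s : State) (hk : 3 * k ≤ d)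
    (he : e.Scoped k) (hs : ∀ j < k, s.reg (3 * j) = env j) :
    ∃ s', Exec (e.compile d) s e.time s' ∧ s'.arr = s.arr ∧ s'.reg d = e.eval env s.arr ∧
      ∀ r < d, s'.reg r = s.reg r := by
  induction e generalizing d s with
  | var j =>
    have hj : j < k := he
    refine ⟨_, .seq (.const ..) (.add ..), rfl, ?_, ?_⟩
    · have : 3 * j ≠ d := by omega
      simp [State.setReg, eval, this, hs j hj]
    · intro r hr
      simp [State.setReg, hr.ne]
  | const c =>
    refine ⟨_, .const .., rfl, by simp [State.setReg, eval], fun r hr => ?_⟩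
    simp [State.setReg, hr.ne]
  | add e f ihe ihf =>
    obtain ⟨s₁, h₁, ha₁, hd₁, hr₁⟩ := ihe d s hk he.1 hs
    obtain ⟨s₂, h₂, ha₂, hd₂, hr₂⟩ := ihf (d + 1) s₁ (by omega) he.2
      (fun j hj => by rw [hr₁ _ (by omega), hs j hj])
    refine ⟨_, .seq h₁ (.seq h₂ (.add ..)), ?_, ?_, ?_⟩
    · simp [State.setReg, ha₂, ha₁]
    · simp [State.setReg, eval, hd₂, hr₂ d (by omega), hd₁, ha₁]
    · intro r hr
      simp [State.setReg, hr.ne, hr₂ r (by omega), hr₁ r hr]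
  | sub e f ihe ihf =>
    obtain ⟨s₁, h₁, ha₁, hd₁, hr₁⟩ := ihe d s hk he.1 hs
    obtain ⟨s₂, h₂, ha₂, hd₂, hr₂⟩ := ihf (d + 1) s₁ (by omega) he.2
      (fun j hj => by rw [hr₁ _ (by omega), hs j hj])
    refine ⟨_, .seq h₁ (.seq h₂ (.sub ..)), ?_, ?_, ?_⟩
    · simp [State.setReg, ha₂, ha₁]
    · simp [State.setReg, eval, hd₂, hr₂ d (by omega), hd₁, ha₁]
    · intro r hr
      simp [State.setReg, hr.ne, hr₂ r (by omega), hr₁ r hr]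
  | load a e ihe =>
    obtain ⟨s₁, h₁, ha₁, hd₁, hr₁⟩ := ihe d s hk he hs
    refine ⟨_, .seq h₁ (.load ..), ha₁, ?_, ?_⟩
    · simp [State.setReg, eval, hd₁, ha₁]
    · intro r hr
      simp [State.setReg, hr.ne, hr₁ r hr]

end Expr

/-- `f (n - 1) (⋯ (f 0 x))`. -/
def iter {α : Type} (f : ℕ → α → α) : ℕ → α → α
  | 0, x => x
  | n + 1, x => f n (iter f n x)

theorem iter_induction {α : Type} {f : ℕ → α → α} {x : α} {n : ℕ} (I : ℕ → α → Prop)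
    (h0 : I 0 x) (hs : ∀ j < n, ∀ y, I j y → I (j + 1) (f j y)) : I n (iter f n x) := by
  induction n with
  | zero => exact h0
  | succ n ih => exact hs n n.lt_succ_self _ (ih fun j hj => hs j (by omega))

/-- Statements; array `0` is never written, and its first cell plus `b` is the number of rounds of
the loop `rep b P`. -/
inductive Stmt where
  | store (a : ℕ) (e f : Expr)
  | seq (P Q : Stmt)
  | ite (e : Expr) (P : Stmt)
  | rep (b : ℕ) (P : Stmt)

namespace Stmt

def sem : Stmt → ℕ → (ℕ → ℕ) → Arrays → Arrays
  | store a e f, _, env, A => A.set (a + 1) (e.eval env A) (f.eval env A)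
  | seq P Q, k, env, A => Q.sem k env (P.sem k env A)
  | ite e P, k, env, A => if e.eval env A ≠ 0 then P.sem k env A else A
  | .rep b P, k, env, A =>
      iter (fun j A => P.sem (k + 1) (Function.update env k j) A) (A 0 0 + b) A

def Scoped : ℕ → Stmt → Prop
  | k, store _ e f => e.Scoped k ∧ f.Scoped k
  | k, seq P Q => P.Scoped k ∧ Q.Scoped k
  | k, ite e P => e.Scoped k ∧ P.Scoped k
  | k, .rep _ P => P.Scoped (k + 1)

/-- A loop at depth `k` owns the registers `3 * k` (loop variable), `3 * k + 1` (number of rounds)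
and `3 * k + 2` (rounds left, tested by the machine loop). Statements at depth `k` use the registers
from `3 * k` on as scratch. The `const` in the second branch of `ite` is a dummy. -/
def compile : Stmt → ℕ → Program
  | store a e f, k =>
      .seq (e.compile (3 * k)) (.seq (f.compile (3 * k + 1)) (.store (a + 1) (3 * k) (3 * k + 1)))
  | seq P Q, k => .seq (P.compile k) (Q.compile k)
  | ite e P, k => .seq (e.compile (3 * k)) (.branch (3 * k) (P.compile k) (.const (3 * k) 0))
  | .rep b P, k =>
      .seq (.const (3 * k) 0) <| .seq (.load (3 * k + 1) 0 (3 * k)) <|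
      .seq (.const (3 * k + 2) b) <| .seq (.add (3 * k + 1) (3 * k + 1) (3 * k + 2)) <|
      .seq (.sub (3 * k + 2) (3 * k + 1) (3 * k)) <|
      .loop (3 * k + 2) <| .seq (P.compile (k + 1)) <| .seq (.const (3 * k + 2) 1) <|
        .seq (.add (3 * k) (3 * k) (3 * k + 2)) (.sub (3 * k + 2) (3 * k + 1) (3 * k))

/-- Upper bound for the running time in terms of the first cell of array `0`. -/
noncomputable def time : Stmt → Polynomial ℕ
  | store _ e f => ↑(e.time + f.time + 1)
  | seq P Q => P.time + Q.time
  | ite e P => ↑(e.time + 2) + P.time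
  | .rep b P => 6 + (Polynomial.X + (b : Polynomial ℕ)) * (P.time + 4)

/-- Stores go to array `a + 1`, never to `0`. Thus loop bounds stay fixed throughout a run, and time
bounds in terms of the first input cell compose. -/
theorem sem_zero (P : Stmt) (k : ℕ) (env : ℕ → ℕ) (A : Arrays) : P.sem k env A 0 = A 0 := by
  induction P generalizing k env A with
  | store a e f => simp [sem, Arrays.set]
  | seq P Q ihP ihQ => simp [sem, ihP, ihQ]
  | ite e P ih =>
    simp only [sem]
    split_ifs <;> simp [ih]
  | rep b P ih =>
    exact iter_induction (fun _ (A' : Arrays) => A' 0 = A 0) rfl fun j _ y hy => by rw [ih, hy]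

theorem exec_compile (P : Stmt) (k : ℕ) (env : ℕ → ℕ) (s : State) (hP : P.Scoped k)
    (hs : ∀ j < k, s.reg (3 * j) = env j) :
    ∃ t s', Exec (P.compile k) s t s' ∧ t ≤ P.time.eval (s.arr 0 0) ∧
      s'.arr = P.sem k env s.arr ∧ ∀ r < 3 * k, s'.reg r = s.reg r := by
  induction P generalizing k env s with
  | store a e f =>
    obtain ⟨s₁, h₁, ha₁, hd₁, hr₁⟩ := e.exec_compile (3 * k) s le_rfl hP.1 hs
    obtain ⟨s₂, h₂, ha₂, hd₂, hr₂⟩ := f.exec_compile (env := env) (3 * k + 1) s₁ (by omega) hP.2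
      (fun j hj => by rw [hr₁ _ (by omega), hs j hj])
    refine ⟨_, _, .seq h₁ (.seq h₂ (.store ..)), ?_, ?_, ?_⟩
    · simp [time, Nat.add_assoc]
    · simp [sem, State.setCell, Arrays.set, ha₂, ha₁, hd₂, hr₂ (3 * k) (by omega), hd₁]
    · intro r hr
      simp [State.setCell, hr₂ r (by omega), hr₁ r hr]
  | seq P Q ihP ihQ =>
    obtain ⟨t₁, s₁, h₁, ht₁, ha₁, hr₁⟩ := ihP k env s hP.1 hs
    obtain ⟨t₂, s₂, h₂, ht₂, ha₂, hr₂⟩ := ihQ k env s₁ hP.2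
      (fun j hj => by rw [hr₁ _ (by omega), hs j hj])
    refine ⟨_, _, .seq h₁ h₂, ?_, by simp [sem, ha₂, ha₁], fun r hr => by rw [hr₂ r hr, hr₁ r hr]⟩
    rw [ha₁, sem_zero] at ht₂
    simp only [time, Polynomial.eval_add]
    omega
  | ite e P ih =>
    obtain ⟨s₁, h₁, ha₁, hd₁, hr₁⟩ := e.exec_compile (3 * k) s le_rfl hP.1 hs
    by_cases he : e.eval env s.arr = 0
    · refine ⟨_, _, .seq h₁ (.branchFalse (by rw [hd₁, he]) (.const ..)), ?_, ?_, ?_⟩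
      · simp [time]
      · simp [sem, he, State.setReg, ha₁]
      · intro r hr
        simp [State.setReg, hr.ne, hr₁ r hr]
    · obtain ⟨t₂, s₂, h₂, ht₂, ha₂, hr₂⟩ := ih k env s₁ hP.2
        (fun j hj => by rw [hr₁ _ (by omega), hs j hj])
      refine ⟨_, _, .seq h₁ (.branchTrue (by rwa [hd₁]) h₂), ?_, ?_, ?_⟩
      · rw [ha₁] at ht₂
        simp [time]
        omega
      · simp [sem, he, ha₂, ha₁]
      · intro r hr
        rw [hr₂ r hr, hr₁ r hr]
  | rep b P ih =>
    set f : ℕ → Arrays → Arrays := fun j A => P.sem (k + 1) (Function.update env k j) A with hf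
    set n := s.arr 0 0 with hn
    -- Induction on the number `m` of rounds left, after `j` rounds.
    have key : ∀ m j (s₀ : State), j + m = n + b → s₀.reg (3 * k) = j →
        s₀.reg (3 * k + 1) = n + b → s₀.reg (3 * k + 2) = n + b - j →
        (∀ i < k, s₀.reg (3 * i) = env i) → s₀.arr = iter f j s.arr →
        ∃ t s', Exec (.loop (3 * k + 2) <| .seq (P.compile (k + 1)) <| .seq (.const (3 * k + 2) 1) <|
          .seq (.add (3 * k) (3 * k) (3 * k + 2)) (.sub (3 * k + 2) (3 * k + 1) (3 * k))) s₀ t s' ∧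
          t ≤ m * (P.time.eval n + 4) + 1 ∧ s'.arr = iter f (n + b) s.arr ∧
          ∀ r < 3 * k, s'.reg r = s₀.reg r := by
      intro m
      induction m with
      | zero =>
        intro j s₀ hj h0 h1 h2 henv harr
        refine ⟨_, _, .loopStop (by omega), by omega, ?_, fun _ _ => rfl⟩
        rw [harr, ← hj, Nat.add_zero]
      | succ m ihm =>
        intro j s₀ hj h0 h1 h2 henv harr
        have hz : s₀.arr 0 0 = n := by
          rw [harr]
          exact iter_induction (fun _ (A : Arrays) => A 0 0 = n) rfl fun i _ y hy => by
            rw [← hy, hf]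
            simp only [sem_zero]
        obtain ⟨t₁, s₁, e₁, ht₁, ha₁, hr₁⟩ := ih (k + 1) (Function.update env k j) s₀ hP
          (fun i hi => by
            rcases Nat.lt_succ_iff_lt_or_eq.mp hi with h | rfl
            · simp [h.ne, henv i h]
            · simpa using h0)
        obtain ⟨t₂, s₂, e₂, ht₂, ha₂, hr₂⟩ := ihm (j + 1)
          (((s₁.setReg (3 * k + 2) 1).setReg (3 * k) (j + 1)).setReg (3 * k + 2) (n + b - (j + 1)))
          (by omega) (by simp [State.setReg]) (by simp [State.setReg, hr₁ (3 * k + 1) (by omega), h1])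
          (by simp [State.setReg])
          (fun i hi => by
            have h3 : 3 * i ≠ 3 * k := by omega
            have h4 : 3 * i ≠ 3 * k + 2 := by omega
            simp [State.setReg, h3, h4, hr₁ (3 * i) (by omega), henv i hi])
          (by simp [State.setReg, ha₁, iter, hf, harr])
        refine ⟨t₁ + (1 + (1 + 1)) + t₂ + 1, s₂, .loopStep (by omega)
          (.seq e₁ (.seq (.const ..) (.seq (.add ..) (.sub ..)))) ?_, ?_, ha₂, ?_⟩
        · convert e₂ using 3
          · simp [State.setReg, hr₁ (3 * k) (by omega), h0]
          · simp [State.setReg, hr₁ (3 * k + 1) (by omega), h1]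
          · simp [State.setReg, hr₁ (3 * k) (by omega), h0]
        · rw [hz] at ht₁
          linarith [Nat.succ_mul m (P.time.eval n + 4)]
        · intro r hr
          rw [hr₂ r hr]
          have h3 : r ≠ 3 * k := by omega
          have h4 : r ≠ 3 * k + 2 := by omega
          simp [State.setReg, h3, h4, hr₁ r (by omega)]
    obtain ⟨t, s', e, ht, ha, hr⟩ := key (n + b) 0
      (((((s.setReg (3 * k) 0).setReg (3 * k + 1) n).setReg (3 * k + 2) b).setReg (3 * k + 1)
        (n + b)).setReg (3 * k + 2) (n + b))
      (by omega) (by simp [State.setReg]) (by simp [State.setReg]) (by simp [State.setReg])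
      (fun i hi => by
        have h3 : 3 * i ≠ 3 * k := by omega
        have h4 : 3 * i ≠ 3 * k + 2 := by omega
        have h5 : 3 * i ≠ 3 * k + 1 := by omega
        simp [State.setReg, h3, h4, h5, hs i hi])
      rfl
    refine ⟨1 + (1 + (1 + (1 + (1 + t)))), s', .seq (.const ..) (.seq (.load ..) (.seq (.const ..)
      (.seq (.add ..) (.seq (.sub ..) ?_)))), ?_, ?_, ?_⟩
    · convert e using 2
      · simp [State.setReg, hn]
      · simp [State.setReg, hn]
    · simp only [time, Polynomial.eval_add, Polynomial.eval_mul, Polynomial.eval_X,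
        Polynomial.eval_natCast, Polynomial.eval_ofNat]
      simp only [Nat.cast_id]
      omega
    · exact ha
    · intro r hr'
      rw [hr r hr']
      have h3 : r ≠ 3 * k := by omega
      have h4 : r ≠ 3 * k + 2 := by omega
      have h5 : r ≠ 3 * k + 1 := by omega
      simp [State.setReg, h3, h4, h5]

end Stmt

end Imp

/-! ### Matching by bids -/

namespace Auction

open Imp

/-- Vertex `v` is taken over by `p` and gets label `ℓ + 1`. Array `3` holds the labels of vertices,
array `4` their owners, array `5` the partners (increased by one) of the owners. -/
def take (A : Arrays) (p ℓ v : ℕ) : Arrays :=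
  (((A.set 5 (A 4 v) 0).set 4 v p).set 5 p (v + 1)).set 3 v (ℓ + 1)

/-- Invariant of the matching between bidders and vertices, for the admissibility relation `N`. -/
structure Inv (N : ℕ → ℕ → Prop) (L : ℕ) (A₀ A : Arrays) : Prop where
  frame : ∀ a, a ≠ 3 → a ≠ 4 → a ≠ 5 → A a = A₀ a
  own_eq_zero : ∀ v, A 3 v = 0 → A 4 v = 0
  own_spec : ∀ v, A 3 v ≠ 0 → N (A 4 v) v ∧ A 5 (A 4 v) = v + 1
  partner_spec : ∀ p ≠ 0, A 5 p ≠ 0 → ∃ v, A 5 p = v + 1 ∧ A 3 v ≠ 0 ∧ A 4 v = p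
  label_le : ∀ v, A 3 v ≤ L
  label_le_label : ∀ v u, A 3 v ≠ 0 → N (A 4 v) u → A 3 v ≤ A 3 u + 1

/-- An unmatched `p` has only partners with the largest label. -/
def Done (N : ℕ → ℕ → Prop) (L : ℕ) (A : Arrays) (p : ℕ) : Prop :=
  A 5 p = 0 → ∀ u, N p u → L ≤ A 3 u

/-- Sum of the labels. -/
def total (n : ℕ) (A : Arrays) : ℕ :=
  ∑ v ∈ Finset.range n, A 3 v

section

variable {N : ℕ → ℕ → Prop} {L n : ℕ} {A₀ A : Arrays} {p ℓ v : ℕ}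

theorem take_label (u : ℕ) : take A p ℓ v 3 u = if u = v then ℓ + 1 else A 3 u := by
  simp [take, Arrays.set, Function.update_apply]

theorem take_own (u : ℕ) : take A p ℓ v 4 u = if u = v then p else A 4 u := by
  simp [take, Arrays.set, Function.update_apply]

theorem take_partner (q : ℕ) :
    take A p ℓ v 5 q = if q = p then v + 1 else if q = A 4 v then 0 else A 5 q := by
  simp [take, Arrays.set, Function.update_apply]

/-- Labels only grow, and the new label is one above the minimum over the vertices admissible for
`p`; this keeps the label comparison. Owner `0` means no owner, so releasing the owner of a free
vertex only clears cell `0`, which belongs to no bidder. -/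
theorem Inv.take (hN : ∀ p v, N p v → p ≠ 0) (h : Inv N L A₀ A) (hpv : N p v) (hp : A 5 p = 0)
    (hv : A 3 v = ℓ) (hℓ : ℓ < L) (hmin : ∀ u, N p u → ℓ ≤ A 3 u) :
    Inv N L A₀ (take A p ℓ v) := by
  have hmono (u : ℕ) : A 3 u ≤ Auction.take A p ℓ v 3 u := by
    rw [take_label]
    split_ifs with hu
    · subst hu
      omega
    · exact le_rfl
  constructor
  · intro a h3 h4 h5
    rw [← h.frame a h3 h4 h5]
    simp [Auction.take, Arrays.set, h3, h4, h5]
  · intro u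
    rw [take_label, take_own]
    split_ifs
    · simp
    · exact h.own_eq_zero u
  · intro u
    rw [take_label, take_own]
    split_ifs with hu
    · subst hu
      intro _
      exact ⟨hpv, by simp [take_partner]⟩
    · intro hd
      obtain ⟨h1, h2⟩ := h.own_spec u hd
      refine ⟨h1, ?_⟩
      rw [take_partner, if_neg, if_neg, h2]
      -- If `u ≠ v` had the same owner as `v`, then this owner would be `0` or have two partners.
      · intro heq
        by_cases hv0 : A 3 v = 0
        · exact hN _ _ h1 (heq.trans (h.own_eq_zero v hv0))
        · have := (h.own_spec v hv0).2
          rw [← heq] at this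
          omega
      · intro heq
        rw [heq] at h2
        omega
  · intro q hq
    rw [take_partner]
    split_ifs with h1 h2
    · intro _
      exact ⟨v, rfl, by simp [take_label], by simp [take_own, h1]⟩
    · simp
    · intro hd
      obtain ⟨w, hw1, hw2, hw3⟩ := h.partner_spec q hq hd
      have : w ≠ v := by
        rintro rfl
        exact h2 hw3.symm
      exact ⟨w, hw1, by simpa [take_label, this] using hw2, by simpa [take_own, this] using hw3⟩
  · intro u
    rw [take_label]
    split_ifs
    · exact hℓ
    · exact h.label_le u
  · intro w u
    rw [take_label, take_own]
    split_ifs with hw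
    · intro _ hu
      have := hmin u hu
      have := hmono u
      omega
    · intro hd hu
      have := h.label_le_label w u hd hu
      have := hmono u
      omega

theorem total_lt_total_take (hvn : v < n) (hv : A 3 v = ℓ) :
    total n A < total n (take A p ℓ v) := by
  refine Finset.sum_lt_sum (fun u _ => ?_) ⟨v, Finset.mem_range.mpr hvn, by simp [take_label, hv]⟩
  rw [take_label]
  split_ifs with hu
  · subst hu
    omega
  · exact le_rfl

open Classical in
/-- The bidder `p` takes `v` if that is admissible, `p` is unmatched and `v` has label `ℓ`. -/
noncomputable def bid (N : ℕ → ℕ → Prop) (A : Arrays) (p ℓ v : ℕ) : Arrays :=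
  if N p v ∧ A 5 p = 0 ∧ A 3 v = ℓ then take A p ℓ v else A

/-- The outcome `A'` of bids of `p` for vertices with label less than `ℓ`. -/
def Outcome (N : ℕ → ℕ → Prop) (L n : ℕ) (A₀ A : Arrays) (p : ℕ) (ℓ : ℕ → ℕ) (A' : Arrays) : Prop :=
  Inv N L A₀ A' ∧ ((A' = A ∧ (A 5 p = 0 → ∀ u, N p u → ℓ u ≤ A 3 u)) ∨
    (A' 5 p ≠ 0 ∧ ¬ Done N L A p ∧ total n A < total n A'))

/-- Until `p` succeeds nothing changes, and all smaller labels have been excluded, so the first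
success is at a least label. After it `p` is matched and further bids are void. -/
theorem Outcome.bid (hN : ∀ p v, N p v → p ≠ 0 ∧ v < n) (hℓ : ℓ < L) {A' : Arrays}
    (h : Outcome N L n A₀ A p (fun u => if u < v then ℓ + 1 else ℓ) A') :
    Outcome N L n A₀ A p (fun u => if u < v + 1 then ℓ + 1 else ℓ) (bid N A' p ℓ v) := by
  obtain ⟨hI, ⟨rfl, h1⟩ | ⟨h1, h2, h3⟩⟩ := h
  · unfold Auction.bid
    split_ifs with hc
    · obtain ⟨hpv, hp, hv⟩ := hc
      refine ⟨hI.take (fun p v h => (hN p v h).1) hpv hp hv hℓ ?_, Or.inr ⟨?_, ?_, ?_⟩⟩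
      · intro u hu
        have := h1 hp u hu
        dsimp only at this
        split_ifs at this <;> omega
      · simp [take_partner]
      · intro hD
        have := hD hp v hpv
        omega
      · exact total_lt_total_take (hN p v hpv).2 hv
    · refine ⟨hI, Or.inl ⟨rfl, fun hp u hu => ?_⟩⟩
      have := h1 hp u hu
      by_cases huv : u = v
      · subst huv
        have h4 : A' 3 u ≠ ℓ := fun h => hc ⟨hu, hp, h⟩
        simp only [lt_self_iff_false, if_false] at this
        simp only [Nat.lt_succ_self, if_true]
        omega
      · have : u < v + 1 ↔ u < v := by omega
        simpa only [this] using h1 hp u hu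
  · unfold Auction.bid
    rw [if_neg fun hc => h1 hc.2.1]
    exact ⟨hI, Or.inr ⟨h1, h2, h3⟩⟩

/-- After bids for all vertices with increasing labels, either nothing has changed since there was
nothing to do, or the sum of the labels has increased. -/
theorem iter_bid (hN : ∀ p v, N p v → p ≠ 0 ∧ v < n) {F : ℕ → Arrays → Arrays}
    {f : ℕ → ℕ → Arrays → Arrays}
    (hF : ∀ A', Inv N L A₀ A' → ∀ ℓ < L, F ℓ A' = iter (f ℓ) n A')
    (hf : ∀ A', Inv N L A₀ A' → ∀ ℓ < L, ∀ v < n, f ℓ v A' = bid N A' p ℓ v)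
    (hA : Inv N L A₀ A) :
    Inv N L A₀ (iter F L A) ∧ ((iter F L A = A ∧ Done N L A p) ∨
      (¬ Done N L A p ∧ total n A < total n (iter F L A))) := by
  have key : Outcome N L n A₀ A p (fun _ => L) (iter F L A) := by
    refine iter_induction (fun ℓ A' => Outcome N L n A₀ A p (fun _ => ℓ) A') ?_ ?_
    · exact ⟨hA, Or.inl ⟨rfl, fun _ _ _ => Nat.zero_le _⟩⟩
    · intro ℓ hℓ A' hA'
      rw [hF A' hA'.1 ℓ hℓ]
      have : Outcome N L n A₀ A p (fun u => if u < n then ℓ + 1 else ℓ) (iter (f ℓ) n A') := by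
        refine iter_induction
          (fun v A'' => Outcome N L n A₀ A p (fun u => if u < v then ℓ + 1 else ℓ) A'') ?_ ?_
        · simpa using hA'
        · intro v hv A'' hA''
          rw [hf A'' hA''.1 ℓ hℓ v hv]
          exact hA''.bid hN hℓ
      refine ⟨this.1, this.2.imp (fun h => ⟨h.1, fun hp u hu => ?_⟩) id⟩
      have h2 := h.2 hp u hu
      dsimp only at h2
      rwa [if_pos (hN p u hu).2] at h2
  exact ⟨key.1, key.2.imp (fun h => ⟨h.1, h.2⟩) fun h => h.2⟩

theorem total_le (h : Inv N L A₀ A) : total n A ≤ n * L := by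
  have := Finset.sum_le_card_nsmul (Finset.range n) (A 3) L fun v _ => h.label_le v
  simpa [total] using this

end

end Auction

/-! ### Rerouting cycles through labeled vertices -/

open SimpleGraph in
/-- Let every neighbor of `R` lie in `S`. If the ordered pairs of vertices of `S` are matched by `μ`
into `R`, with `own` as inverse, so that the label of the partner of a pair exceeds that of no common
neighbor by more than one, then cycles need no vertices of `R` with label `0`. -/
theorem cycleGraph_isContained_of_labeling {V : Type*} {Q Q' : SimpleGraph V} {R : Set V}
    {S : Finset V} {L : ℕ} (d : V → ℕ) (μ : V → V → V) (own : V → V × V) (hS : S.card < L)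
    (hSR : ∀ x ∈ S, x ∉ R) (hR : ∀ v ∈ R, ∀ u, Q.Adj v u → u ∈ S)
    (hQ : ∀ u v, u ∉ R → v ∉ R → Q.Adj u v → Q'.Adj u v)
    (hμ : ∀ x ∈ S, ∀ y ∈ S, ∀ u ∈ R, Q.Adj x u → Q.Adj y u → d u < L →
      μ x y ∈ R ∧ Q'.Adj x (μ x y) ∧ Q'.Adj y (μ x y) ∧ d (μ x y) ≤ d u + 1 ∧ own (μ x y) = (x, y))
    (hd : ∀ x, ∀ u ∈ R, d u ≠ 0 → Q.Adj x u → Q'.Adj x u)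
    {n : ℕ} (hn : 2 < n) (h : cycleGraph n ⊑ Q) : cycleGraph n ⊑ Q' := by
  classical
  obtain ⟨m, rfl⟩ : ∃ m, n = m + 2 := ⟨n - 2, by omega⟩
  obtain ⟨f⟩ := h
  have hinj : Function.Injective f := f.injective
  have hsucc (i) : Q.Adj (f i) (f (i + 1)) := f.toHom.map_adj (by simp [cycleGraph_adj])
  have hpred (i) : Q.Adj (f i) (f (i - 1)) := f.toHom.map_adj (by simp [cycleGraph_adj])
  -- Pigeonhole: if every label below `L` occurred on the cycle, then the successors of these
  -- vertices would be `L` distinct elements of `S`.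
  obtain ⟨j, hjL, hj⟩ : ∃ j < L, ∀ i, f i ∈ R → d (f i) ≠ j := by
    by_contra! hcon
    choose! i hiR hid using hcon
    have : (Finset.range L).card ≤ S.card := by
      refine Finset.card_le_card_of_injOn (fun j => f (i j + 1)) ?_ ?_
      · intro j hj
        exact hR _ (hiR j (by simpa using hj)) _ (hsucc _)
      · intro a ha b hb hab
        have := add_right_cancel (hinj hab)
        rw [← hid a (by simpa using ha), ← hid b (by simpa using hb), this]
    simp at this
    omega
  set g : Fin (m + 2) → V := fun i =>
    if f i ∈ R ∧ d (f i) < j then μ (f (i - 1)) (f (i + 1)) else f i with hg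
  have hgpos (i) (hi : f i ∈ R ∧ d (f i) < j) : g i = μ (f (i - 1)) (f (i + 1)) := if_pos hi
  have hgneg (i) (hi : ¬(f i ∈ R ∧ d (f i) < j)) : g i = f i := if_neg hi
  have hmu (i) (hi : f i ∈ R ∧ d (f i) < j) :=
    hμ _ (hR _ hi.1 _ (hpred i)) _ (hR _ hi.1 _ (hsucc i)) _ hi.1 (hpred i).symm (hsucc i).symm
      (by omega)
  have hgR (i) (hi : f i ∈ R) : Q'.Adj (f (i - 1)) (g i) ∧ Q'.Adj (f (i + 1)) (g i) := by
    by_cases h : f i ∈ R ∧ d (f i) < j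
    · rw [hgpos i h]
      exact ⟨(hmu i h).2.1, (hmu i h).2.2.1⟩
    · rw [hgneg i h]
      -- The label `j` does not occur, so a vertex of label `0` in `R` has label below `j` and was
      -- replaced.
      have h0 : d (f i) ≠ 0 := by
        intro h0
        have := hj i hi
        exact h ⟨hi, by omega⟩
      exact ⟨hd _ _ hi h0 (hpred i).symm, hd _ _ hi h0 (hsucc i).symm⟩
  have hadj (i) : Q'.Adj (g i) (g (i + 1)) := by
    by_cases h1 : f i ∈ R
    · have h2 : f (i + 1) ∉ R := hSR _ (hR _ h1 _ (hsucc i))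
      rw [hgneg (i + 1) fun h => h2 h.1]
      exact (hgR i h1).2.symm
    · rw [hgneg i fun h => h1 h.1]
      by_cases h2 : f (i + 1) ∈ R
      · simpa using (hgR _ h2).1
      · rw [hgneg _ fun h => h2 h.1]
        exact hQ _ _ h1 h2 (hsucc i)
  -- A new vertex has label at most `j`, an old one in `R` has label greater than `j`.
  have hne (a b) (ha : f a ∈ R ∧ d (f a) < j) (hb : ¬(f b ∈ R ∧ d (f b) < j)) : g a ≠ g b := by
    rw [hgpos a ha, hgneg b hb]
    intro hab
    obtain ⟨h1, -, -, h2, -⟩ := hmu a ha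
    rw [hab] at h1 h2
    have := hj b h1
    exact hb ⟨h1, by omega⟩
  refine ⟨⟨⟨g, ?_⟩, ?_⟩⟩
  · intro a b hab
    rcases cycleGraph_adj.mp hab with h | h
    · rw [← sub_add_cancel a b, h, add_comm]
      exact (hadj b).symm
    · rw [← sub_add_cancel b a, h, add_comm]
      exact hadj a
  · intro a b hab
    change g a = g b at hab
    by_cases ha : f a ∈ R ∧ d (f a) < j <;> by_cases hb : f b ∈ R ∧ d (f b) < j
    -- The owner recovers the two cycle neighbors, and the successor alone already determines the
    -- position.
    · have h1 := (hmu a ha).2.2.2.2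
      rw [← hgpos a ha, hab, hgpos b hb, (hmu b hb).2.2.2.2] at h1
      exact (add_right_cancel (hinj (Prod.ext_iff.mp h1).2)).symm
    · exact absurd hab (hne a b ha hb)
    · exact absurd hab.symm (hne b a hb ha)
    · rw [hgneg a ha, hgneg b hb] at hab
      exact hinj hab

/-! ### Long Cycle, induced subgraphs and gluing equivalence -/

namespace FinGraph

open SimpleGraph

/-- Copies of `cycleGraph n` are functions on `Fin n`, which are easier to reroute vertex by vertex
than closed walks. -/
theorem longCycleOpt_le_iff {α : Type} (G : FinGraph α) (b : EReal) :
    G.longCycleOpt ≤ b ↔ ∀ n : ℕ, 2 < n → cycleGraph n ⊑ G.graph → ((n : ℝ) : EReal) ≤ b := by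
  simp only [longCycleOpt, iSup_le_iff]
  constructor
  · intro h n hn hc
    obtain ⟨v, c, hcyc, rfl⟩ := (cycleGraph_isContained_iff hn).mp hc
    exact h v c hcyc
  · intro h v c hc
    exact h _ hc.three_le_length ((cycleGraph_isContained_iff hc.three_le_length).mpr ⟨v, c, hc, rfl⟩)

theorem longCycleOpt_le_of_isContained {α : Type} {G G' : FinGraph α}
    (h : ∀ n, 2 < n → cycleGraph n ⊑ G.graph → cycleGraph n ⊑ G'.graph) :
    G.longCycleOpt ≤ G'.longCycleOpt :=
  (longCycleOpt_le_iff _ _).mpr fun n hn hc =>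
    (longCycleOpt_le_iff _ _).mp le_rfl n hn (h n hn hc)

/-- The induced subgraph on the vertices in `K`. -/
def restrict (G : FinGraph ℕ) (K : Finset ℕ) : FinGraph ℕ where
  verts := K ∩ G.verts
  graph :=
    { Adj := fun u v => G.graph.Adj u v ∧ u ∈ K ∧ v ∈ K
      symm := ⟨fun _ _ h => ⟨h.1.symm, h.2.2, h.2.1⟩⟩
      loopless := ⟨fun _ h => h.1.ne rfl⟩ }
  mem_of_adj := fun u v h => Finset.mem_inter.mpr ⟨h.2.1, G.mem_of_adj u v h.1⟩

theorem restrict_verts {G : FinGraph ℕ} {K : Finset ℕ} (h : K ⊆ G.verts) :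
    (G.restrict K).verts = K :=
  Finset.inter_eq_left.mpr h

theorem IsVertexCover.restrict {G : FinGraph ℕ} {S K : Finset ℕ} (h : G.IsVertexCover S)
    (hS : S ⊆ K) : (G.restrict K).IsVertexCover S :=
  ⟨Finset.subset_inter hS h.1, fun _ _ hab => h.2 hab.1⟩

theorem size_le (G : FinGraph ℕ) : G.size ≤ G.verts.card + G.verts.card ^ 2 := by
  have : G.graph.edgeSet ⊆ ((G.verts ×ˢ G.verts).image fun p => s(p.1, p.2) : Finset (Sym2 ℕ)) := by
    intro e
    induction e with
    | _ u v =>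
      intro h
      have h : G.graph.Adj u v := h
      exact Finset.mem_coe.mpr (Finset.mem_image.mpr ⟨(u, v), Finset.mem_product.mpr
        ⟨G.mem_of_adj _ _ h, G.mem_of_adj _ _ h.symm⟩, rfl⟩)
  have h2 := Set.ncard_le_ncard this (Finset.finite_toSet _)
  rw [Set.ncard_coe_finset] at h2
  have h3 := h2.trans Finset.card_image_le
  rw [Finset.card_product, ← sq] at h3
  exact Nat.add_le_add_left h3 _

/-- Labels and a matching of ordered pairs of vertices of `S` into the vertices outside `B ∪ S`. -/
structure Labeling (G : FinGraph ℕ) (B S : Finset ℕ) (L : ℕ) where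
  d : ℕ → ℕ
  μ : ℕ → ℕ → ℕ
  own : ℕ → ℕ × ℕ
  own_mem : ∀ u ∈ G.verts, u ∉ B → u ∉ S → d u ≠ 0 → (own u).1 ∈ S ∧ (own u).2 ∈ S ∧
    μ (own u).1 (own u).2 = u
  μ_spec : ∀ x ∈ S, ∀ y ∈ S, ∀ u ∈ G.verts, u ∉ B → u ∉ S → G.graph.Adj x u → G.graph.Adj y u →
    d u < L → μ x y ∈ G.verts ∧ μ x y ∉ B ∧ μ x y ∉ S ∧ d (μ x y) ≠ 0 ∧ G.graph.Adj x (μ x y) ∧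
      G.graph.Adj y (μ x y) ∧ d (μ x y) ≤ d u + 1 ∧ own (μ x y) = (x, y)

namespace Labeling

variable {G : FinGraph ℕ} {B S : Finset ℕ} {L : ℕ}

/-- The boundary, the cover and the vertices with positive label. -/
def kept (F : G.Labeling B S L) : Finset ℕ :=
  G.verts.filter fun u => u ∈ B ∨ u ∈ S ∨ F.d u ≠ 0

/-- A kept vertex outside `B ∪ S` is the partner of its owner, so such vertices lie in the image of
`S ×ˢ S` under `F.μ`. -/
theorem card_kept_le (F : G.Labeling B S L) :
    F.kept.card ≤ 2 * (B.card + S.card) ^ 2 := by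
  classical
  have h1 : F.kept ⊆ (B ∪ S) ∪ (S ×ˢ S).image fun p => F.μ p.1 p.2 := by
    intro u hu
    obtain ⟨hu, h⟩ := Finset.mem_filter.mp hu
    by_cases hB : u ∈ B
    · simp [hB]
    by_cases hS : u ∈ S
    · simp [hS]
    have := F.own_mem u hu hB hS (by tauto)
    refine Finset.mem_union_right _ (Finset.mem_image.mpr ⟨F.own u, ?_, this.2.2⟩)
    exact Finset.mem_product.mpr ⟨this.1, this.2.1⟩
  have h2 := Finset.card_le_card h1
  have h3 := Finset.card_union_le (B ∪ S) ((S ×ˢ S).image fun p => F.μ p.1 p.2)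
  have h4 := Finset.card_union_le B S
  have h5 : ((S ×ˢ S).image fun p => F.μ p.1 p.2).card ≤ S.card * S.card := by
    rw [← Finset.card_product]
    exact Finset.card_image_le
  have h6 : B.card + S.card ≤ (B.card + S.card) ^ 2 := Nat.le_self_pow (by norm_num) _
  have h7 : S.card * S.card ≤ (B.card + S.card) ^ 2 := by
    rw [sq]
    exact Nat.mul_le_mul (by omega) (by omega)
  omega

/-- One inequality is rerouting, which applies because `H` adds no edges at vertices outside `B`;
the other holds since the kernel is a subgraph. -/
theorem gluingEquiv (F : G.Labeling B S L) (hB : B ⊆ G.verts) (hS : G.IsVertexCover S)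
    (hL : S.card < L) : GluingEquiv longCycleOpt B G (G.restrict F.kept) 0 := by
  classical
  intro H _
  simp only [Int.cast_zero, EReal.coe_zero, add_zero]
  have hBk : ∀ u ∈ B, u ∈ F.kept := fun u hu => Finset.mem_filter.mpr ⟨hB hu, Or.inl hu⟩
  have hSk : ∀ u ∈ S, u ∈ F.kept := fun u hu =>
    Finset.mem_filter.mpr ⟨hS.1 hu, Or.inr (Or.inl hu)⟩
  have hvr {u v : ℕ} (h : G.graph.Adj u v) : v ∈ G.verts := G.mem_of_adj _ _ h.symm
  have hpl (w u : ℕ) (h : Sum.inl u = place (B ∩ B) w) : u ∈ B := by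
    unfold place at h
    split_ifs at h with hw
    · rw [Sum.inl.inj h]
      simpa using hw
  apply le_antisymm
  · apply longCycleOpt_le_of_isContained
    intro n hn
    have hadjR {u : ℕ} (hu : u ∉ B) {x : ℕ ⊕ ℕ} (h : (glue G B H B).graph.Adj x (Sum.inl u)) :
        ∃ y, x = Sum.inl y ∧ G.graph.Adj y u := by
      rcases h with ⟨a, b, hab, rfl, h⟩ | ⟨a, b, hab, rfl, h⟩
      · cases h
        exact ⟨a, rfl, hab⟩
      · exact absurd (hpl _ _ h) hu
    -- Labels and owners matter only on `R`; the values at vertices of `H` alone are arbitrary.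
    refine cycleGraph_isContained_of_labeling
      (R := {z | ∃ u ∈ G.verts, u ∉ B ∧ u ∉ S ∧ z = Sum.inl u})
      (S := S.image Sum.inl) (Sum.elim F.d fun _ => 0)
      (fun x y => Sum.inl (F.μ (Sum.elim id id x) (Sum.elim id id y)))
      (fun z => (Sum.inl (F.own (Sum.elim id id z)).1, Sum.inl (F.own (Sum.elim id id z)).2))
      (Finset.card_image_le.trans_lt hL) ?_ ?_ ?_ ?_ ?_ hn
    · rintro x hx ⟨u, -, -, huS, rfl⟩
      simp at hx
      exact huS hx
    · rintro _ ⟨u, hu, huB, huS, rfl⟩ x hx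
      obtain ⟨y, rfl, hy⟩ := hadjR huB hx.symm
      rcases hS.2 hy with h | h
      · simpa using h
      · exact absurd h huS
    · rintro x y hx hy (⟨a, b, hab, rfl, rfl⟩ | h)
      · refine Or.inl ⟨a, b, ⟨hab, ?_, ?_⟩, rfl, rfl⟩
        · have ha := hvr hab.symm
          by_cases h1 : a ∈ B
          · exact hBk _ h1
          by_cases h2 : a ∈ S
          · exact hSk _ h2
          · exact absurd ⟨a, ha, h1, h2, rfl⟩ hx
        · have hb := hvr hab
          by_cases h1 : b ∈ B
          · exact hBk _ h1
          by_cases h2 : b ∈ S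
          · exact hSk _ h2
          · exact absurd ⟨b, hb, h1, h2, rfl⟩ hy
      · exact Or.inr h
    · rintro x hx y hy _ ⟨u, hu, huB, huS, rfl⟩ hxu hyu hdu
      obtain ⟨a, rfl, ha⟩ := hadjR huB hxu
      obtain ⟨b, rfl, hb⟩ := hadjR huB hyu
      have haS : a ∈ S := by simpa using hx
      have hbS : b ∈ S := by simpa using hy
      obtain ⟨h1, h2, h3, h4, h5, h6, h7, h8⟩ := F.μ_spec a haS b hbS u hu huB huS ha hb hdu
      have hk : F.μ a b ∈ F.kept := Finset.mem_filter.mpr ⟨h1, Or.inr (Or.inr h4)⟩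
      refine ⟨⟨_, h1, h2, h3, rfl⟩, Or.inl ⟨a, _, ⟨h5, hSk _ haS, hk⟩, rfl, rfl⟩,
        Or.inl ⟨b, _, ⟨h6, hSk _ hbS, hk⟩, rfl, rfl⟩, h7, ?_⟩
      simp [h8]
    · rintro x _ ⟨u, hu, huB, huS, rfl⟩ hdu hxu
      obtain ⟨a, rfl, ha⟩ := hadjR huB hxu
      have haS : a ∈ S := by
        rcases hS.2 ha with h | h
        · exact h
        · exact absurd h huS
      exact Or.inl ⟨a, u, ⟨ha, hSk _ haS, Finset.mem_filter.mpr ⟨hu, Or.inr (Or.inr hdu)⟩⟩, rfl, rfl⟩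
  · apply longCycleOpt_le_of_isContained
    intro n _ h
    refine h.trans (IsContained.of_le ?_)
    rintro x y (⟨a, b, hab, rfl, rfl⟩ | h)
    · exact Or.inl ⟨a, b, hab.1, rfl, rfl⟩
    · exact Or.inr h

end Labeling

end FinGraph

/-! ### The program -/

namespace Kernel

open Imp Imp.Expr Auction

def num : Expr := load 0 (const 0)

/-- Flag of the boundary. -/
def bflag (e : Expr) : Expr := load 0 (add (add (const 1) num) e)

/-- Flag of the vertex cover. -/
def sflag (e : Expr) : Expr := load 0 (add (add (add (const 1) num) num) e)

/-- Index of an entry of the adjacency matrix. -/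
def entry (e f : Expr) : Expr := add (load 6 e) f

/-- Fill array `6` with the offsets of the rows of the adjacency matrix. -/
def rows : Stmt :=
  .seq (.store 5 (const 0) (add (add (add (const 1) num) num) num))
    (.rep 0 (.store 5 (add (var 0) (const 1)) (add (load 6 (var 0)) num)))

/-- Zero if and only if the pair of the loop variables `2`, `3` may take over the vertex of loop
variable `5` at the label of loop variable `4`. -/
def obstruction : Expr :=
  add (sub (const 1) (sflag (var 2))) <| add (sub (const 1) (sflag (var 3))) <|
  add (bflag (var 5)) <| add (sflag (var 5)) <|
  add (sub (const 1) (load 0 (entry (var 2) (var 5)))) <|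
  add (sub (const 1) (load 0 (entry (var 3) (var 5)))) <|
  add (load 5 (entry (var 2) (var 3))) <|
  add (sub (load 3 (var 5)) (var 4)) (sub (var 4) (load 3 (var 5)))

/-- The address of the matrix entry of `x`, `y` also serves as the name of the pair; it is positive,
which leaves `0` for "no owner". The old owner is released before being overwritten. -/
def bidStmt : Stmt :=
  .ite (sub (const 1) obstruction) <|
    .seq (.store 4 (load 4 (var 5)) (const 0)) <|
    .seq (.store 3 (var 5) (entry (var 2) (var 3))) <|
    .seq (.store 4 (entry (var 2) (var 3)) (add (var 5) (const 1)))
      (.store 2 (var 5) (add (var 4) (const 1)))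

/-- One round of bids of all pairs. -/
def round : Stmt := .rep 0 (.rep 0 (.rep 1 (.rep 0 bidStmt)))

/-- These are `(n + 1) * (n + 1)` rounds, more than the largest possible sum `n * (n + 1)` of the
labels. -/
def auction : Stmt := .rep 1 (.rep 1 round)

/-- The input word `W` describes a graph on `n` vertices, in which the pair with index `p` may be
matched to the vertex with index `v`. -/
def Admissible (W : ℕ → ℕ) (n p v : ℕ) : Prop :=
  ∃ x < n, ∃ y < n, p = 1 + n + n + n + x * n + y ∧ v < n ∧ W (1 + n + n + x) ≠ 0 ∧
    W (1 + n + n + y) ≠ 0 ∧ W (1 + n + v) = 0 ∧ W (1 + n + n + v) = 0 ∧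
    W (1 + n + n + n + x * n + v) ≠ 0 ∧ W (1 + n + n + n + y * n + v) ≠ 0

theorem pair_injective {n x y x' y' : ℕ} (hy : y < n) (hy' : y' < n)
    (h : x * n + y = x' * n + y') : x = x' ∧ y = y' := by
  have h1 : (x * n + y) % n = y := by rw [Nat.mul_add_mod', Nat.mod_eq_of_lt hy]
  have h2 : (x' * n + y') % n = y' := by rw [Nat.mul_add_mod', Nat.mod_eq_of_lt hy']
  have h3 : y = y' := by rw [← h1, h, h2]
  subst h3
  exact ⟨Nat.eq_of_mul_eq_mul_right (by omega) (Nat.add_right_cancel h), rfl⟩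

theorem Admissible.ne_zero_and_lt {W : ℕ → ℕ} {n : ℕ} (p v : ℕ) (h : Admissible W n p v) :
    p ≠ 0 ∧ v < n := by
  obtain ⟨x, -, y, -, rfl, hv, -⟩ := h
  exact ⟨by omega, hv⟩

/-- The arrays contain the input word `W` and the offsets of the rows. -/
structure Ready (W : ℕ → ℕ) (n : ℕ) (A : Arrays) : Prop where
  input : A 0 = W
  num : W 0 = n
  row : ∀ i < n, A 6 i = 1 + n + n + n + i * n

theorem rows_sem (A : Arrays) (env : ℕ → ℕ) :
    Ready (A 0) (A 0 0) (rows.sem 0 env A) ∧ ∀ a, a ≠ 6 → rows.sem 0 env A a = A a := by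
  set n := A 0 0 with hn
  have key : (∀ i ≤ n, rows.sem 0 env A 6 i = 1 + n + n + n + i * n) ∧
      ∀ a, a ≠ 6 → rows.sem 0 env A a = A a := by
    have h0 : (A.set 6 0 (1 + n + n + n)) 0 0 = n := by simp [Arrays.set, hn]
    simp only [rows, Stmt.sem, eval, Kernel.num, ← hn, h0, add_zero]
    refine iter_induction (fun m (A' : Arrays) => (∀ i ≤ m, A' 6 i = 1 + n + n + n + i * n) ∧
      ∀ a, a ≠ 6 → A' a = A a) ⟨fun i hi => ?_, fun a ha => ?_⟩ ?_
    · obtain rfl : i = 0 := by omega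
      simp [Arrays.set]
    · simp [Arrays.set, ha]
    · rintro m - A' ⟨h1, h2⟩
      refine ⟨fun i hi => ?_, fun a ha => ?_⟩
      · rcases Nat.lt_or_eq_of_le hi with hi | rfl
        · have : i ≠ m + 1 := by omega
          simp [Arrays.set, this, h1 i (by omega)]
        · simp [Arrays.set, h1 m le_rfl, h2 0, ← hn]
          ring
      · simp [Arrays.set, ha, h2 a ha]
  exact ⟨⟨key.2 0 (by norm_num), rfl, fun i hi => key.1 i hi.le⟩, key.2⟩

/-! ### Semantics of the auction program -/

section

variable {W : ℕ → ℕ} {n : ℕ} {A₀ A : Arrays}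

/-- The obstruction is a sum of naturals, so it vanishes only if each test does. Equality of two
numbers is tested by both truncated differences. -/
theorem bidStmt_sem (hA : Ready W n A) {k x y ℓ v : ℕ} {env : ℕ → ℕ} (hx : x < n) (hy : y < n)
    (hv : v < n) (h2 : env 2 = x) (h3 : env 3 = y) (h4 : env 4 = ℓ) (h5 : env 5 = v) :
    bidStmt.sem k env A = bid (Admissible W n) A (1 + n + n + n + x * n + y) ℓ v := by
  have hobs : obstruction.eval env A = 0 ↔ Admissible W n (1 + n + n + n + x * n + y) v ∧
      A 5 (1 + n + n + n + x * n + y) = 0 ∧ A 3 v = ℓ := by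
    simp only [obstruction, sflag, bflag, entry, Kernel.num, eval, h2, h3, h4, h5, hA.input, hA.num,
      hA.row x hx, hA.row y hy, Nat.add_eq_zero_iff]
    constructor
    · rintro ⟨g1, g2, g3, g4, g5, g6, g7, g8, g9⟩
      exact ⟨⟨x, hx, y, hy, rfl, hv, by omega, by omega, g3, g4, by omega, by omega⟩, g7, by omega⟩
    · rintro ⟨⟨x', -, y', hy', hxy, -, g1, g2, g3, g4, g5, g6⟩, g7, g8⟩
      obtain ⟨rfl, rfl⟩ := pair_injective (x := x) (x' := x') hy hy' (by omega)
      exact ⟨by omega, by omega, g3, g4, by omega, by omega, g7, by omega, by omega⟩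
  unfold bid
  split_ifs with h
  · have h0 := hobs.mpr h
    simp [bidStmt, Stmt.sem, eval, h0, h2, h3, h4, h5, entry, Arrays.set, hA.row x hx, Auction.take]
  · have h0 : 1 - obstruction.eval env A = 0 := by
      have := mt hobs.mp h
      omega
    simp [bidStmt, Stmt.sem, eval, h0]

theorem Ready.of_inv (hA₀ : Ready W n A₀) (h : Inv (Admissible W n) (n + 1) A₀ A) : Ready W n A := by
  refine ⟨?_, hA₀.num, ?_⟩
  · rw [h.frame 0 (by norm_num) (by norm_num) (by norm_num), hA₀.input]
  · rw [h.frame 6 (by norm_num) (by norm_num) (by norm_num)]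
    exact hA₀.row

theorem pair_sem (hA₀ : Ready W n A₀) (hA : Inv (Admissible W n) (n + 1) A₀ A) {x y : ℕ}
    {env : ℕ → ℕ} (hx : x < n) (hy : y < n) (h2 : env 2 = x) (h3 : env 3 = y) :
    let A' := Stmt.sem (.rep 1 (.rep 0 bidStmt)) 4 env A
    let p := 1 + n + n + n + x * n + y
    Inv (Admissible W n) (n + 1) A₀ A' ∧ ((A' = A ∧ Done (Admissible W n) (n + 1) A p) ∨
      (¬ Done (Admissible W n) (n + 1) A p ∧ total n A < total n A')) := by
  have h0 : A 0 0 = n := by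
    rw [(hA₀.of_inv hA).input, hA₀.num]
  simp only [Stmt.sem, h0, add_zero]
  refine iter_bid Admissible.ne_zero_and_lt (f := fun ℓ v A => bidStmt.sem 6
    (Function.update (Function.update env 4 ℓ) 5 v) A) ?_ ?_ hA
  · intro A' hA' ℓ _
    rw [(hA₀.of_inv hA').input, hA₀.num]
  · intro A' hA' ℓ _ v hv
    exact bidStmt_sem (hA₀.of_inv hA') hx hy hv (by simp [h2]) (by simp [h3]) (by simp) (by simp)

/-- No pair can bid any more. -/
def Stable (W : ℕ → ℕ) (n : ℕ) (A : Arrays) : Prop :=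
  ∀ x < n, ∀ y < n, Done (Admissible W n) (n + 1) A (1 + n + n + n + x * n + y)

/-- As long as no bid succeeds, all pairs have been checked in the same state, which is therefore
stable. The first success refutes stability of the initial state, and the total never falls
afterwards. -/
theorem round_sem (hA₀ : Ready W n A₀) (hA : Inv (Admissible W n) (n + 1) A₀ A) (env : ℕ → ℕ) :
    let A' := round.sem 2 env A
    Inv (Admissible W n) (n + 1) A₀ A' ∧ ((A' = A ∧ Stable W n A) ∨
      (¬ Stable W n A ∧ total n A < total n A')) := by
  have h0 {A' : Arrays} (h : Inv (Admissible W n) (n + 1) A₀ A') : A' 0 0 = n := by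
    rw [(hA₀.of_inv h).input, hA₀.num]
  intro A'
  suffices Inv (Admissible W n) (n + 1) A₀ A' ∧ ((A' = A ∧ ∀ x < n, ∀ y < n,
      Done (Admissible W n) (n + 1) A (1 + n + n + n + x * n + y)) ∨
      (¬ Stable W n A ∧ total n A < total n A')) from this
  simp only [A', round]
  rw [Stmt.sem, h0 hA, add_zero]
  refine iter_induction (fun m A' => Inv (Admissible W n) (n + 1) A₀ A' ∧ ((A' = A ∧ ∀ x < m, ∀ y < n,
      Done (Admissible W n) (n + 1) A (1 + n + n + n + x * n + y)) ∨
      (¬ Stable W n A ∧ total n A < total n A'))) ⟨hA, Or.inl ⟨rfl, by simp⟩⟩ ?_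
  intro x hx A₁ h₁
  rw [Stmt.sem, h0 h₁.1, add_zero]
  have key := iter_induction (n := n) (f := fun j A => Stmt.sem (.rep 1 (.rep 0 bidStmt)) (2 + 1 + 1)
    (Function.update (Function.update env 2 x) (2 + 1) j) A) (x := A₁)
    (fun m A' => Inv (Admissible W n) (n + 1) A₀ A' ∧ ((A' = A ∧
      (∀ x' < x, ∀ y < n, Done (Admissible W n) (n + 1) A (1 + n + n + n + x' * n + y)) ∧ ∀ y < m,
      Done (Admissible W n) (n + 1) A (1 + n + n + n + x * n + y)) ∨
      (¬ Stable W n A ∧ total n A < total n A'))) ⟨h₁.1, h₁.2.imp (fun h => ⟨h.1, h.2, by simp⟩) id⟩ ?_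
  · refine ⟨key.1, key.2.imp (fun h => ⟨h.1, ?_⟩) id⟩
    intro x' hx' y hy
    rcases Nat.lt_succ_iff_lt_or_eq.mp hx' with h' | rfl
    · exact h.2.1 x' h' y hy
    · exact h.2.2 y hy
  · rintro y hy A₂ ⟨hI, h⟩
    obtain ⟨hI', h'⟩ := pair_sem hA₀ hI (env := Function.update (Function.update env 2 x) (2 + 1) y)
      hx hy (by simp) (by simp)
    refine ⟨hI', ?_⟩
    rcases h with ⟨rfl, h3, h4⟩ | ⟨h3, h4⟩
    · rcases h' with ⟨h5, h6⟩ | ⟨h5, h6⟩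
      · refine Or.inl ⟨h5, h3, fun y' hy' => ?_⟩
        rcases Nat.lt_succ_iff_lt_or_eq.mp hy' with h' | rfl
        · exact h4 y' h'
        · exact h6
      · exact Or.inr ⟨fun hS => h5 (hS x hx y hy), h6⟩
    · refine Or.inr ⟨h3, ?_⟩
      rcases h' with ⟨h5, -⟩ | ⟨-, h6⟩
      · rwa [h5]
      · exact h4.trans h6

theorem auction_sem (hA₀ : Ready W n A₀) (hA : Inv (Admissible W n) (n + 1) A₀ A) (env : ℕ → ℕ) :
    Inv (Admissible W n) (n + 1) A₀ (auction.sem 0 env A) ∧ Stable W n (auction.sem 0 env A) := by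
  have h0 {A' : Arrays} (h : Inv (Admissible W n) (n + 1) A₀ A') : A' 0 0 = n := by
    rw [(hA₀.of_inv h).input, hA₀.num]
  have hround {A' : Arrays} (env' : ℕ → ℕ) {t : ℕ} (h : Inv (Admissible W n) (n + 1) A₀ A' ∧
      (Stable W n A' ∨ t ≤ total n A')) : Inv (Admissible W n) (n + 1) A₀ (round.sem 2 env' A') ∧
      (Stable W n (round.sem 2 env' A') ∨ t + 1 ≤ total n (round.sem 2 env' A')) := by
    obtain ⟨h1, h2⟩ := round_sem hA₀ h.1 env'
    refine ⟨h1, ?_⟩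
    rcases h2 with ⟨h2, h3⟩ | ⟨h2, h3⟩
    · rw [h2]
      exact Or.inl h3
    · right
      have := h.2.resolve_left h2
      omega
  have key : Inv (Admissible W n) (n + 1) A₀ (auction.sem 0 env A) ∧
      (Stable W n (auction.sem 0 env A) ∨ (n + 1) * (n + 1) ≤ total n (auction.sem 0 env A)) := by
    rw [auction, Stmt.sem, h0 hA]
    refine iter_induction (fun a A' => Inv (Admissible W n) (n + 1) A₀ A' ∧
      (Stable W n A' ∨ a * (n + 1) ≤ total n A')) ⟨hA, by simp⟩ ?_
    intro a _ A₁ h₁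
    rw [Stmt.sem, h0 h₁.1, Nat.succ_mul]
    exact iter_induction (fun b A' => Inv (Admissible W n) (n + 1) A₀ A' ∧
      (Stable W n A' ∨ a * (n + 1) + b ≤ total n A')) h₁ fun b _ A₂ h₂ => hround _ h₂
  -- Otherwise every round would have increased the total, beyond its upper bound.
  refine ⟨key.1, key.2.resolve_right fun h => ?_⟩
  have := total_le (n := n) key.1
  have : (n + 1) * (n + 1) = n * (n + 1) + (n + 1) := by ring
  omega

end

/-! ### Output of the kernel -/

/-- Nonzero if and only if a vertex is kept. -/
def keep (e : Expr) : Expr := add (bflag e) (add (sflag e) (load 3 e))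

/-- Append a number to the output; array `2` holds the length of the output in its first cell. -/
def append (e : Expr) : Stmt :=
  .seq (.store 0 (load 2 (const 0)) e)
    (.store 1 (const 0) (add (load 2 (const 0)) (const 1)))

/-- Store the number of kept vertices in the second cell of array `2`. -/
def count : Stmt :=
  .rep 0 (.ite (keep (var 0)) (.store 1 (const 1) (add (load 2 (const 1)) (const 1))))

def column (e : Expr) : Stmt := .rep 0 (.ite (keep (var 0)) (append e))

def matrix : Stmt :=
  .rep 0 (.ite (keep (var 0)) (.rep 0 (.ite (keep (var 1))
    (append (load 0 (entry (var 0) (var 1)))))))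

/-- The two leading zeros are the sign and the absolute value of the offset `0`. -/
def emit : Stmt :=
  .seq (append (const 0)) <| .seq (append (const 0)) <| .seq (append (load 2 (const 1))) <|
  .seq (column (load 0 (add (const 1) (var 0)))) <| .seq (column (bflag (var 0))) <|
  .seq (column (sflag (var 0))) matrix

/-- Value of `keep`. -/
def keepVal (W : ℕ → ℕ) (n : ℕ) (A : Arrays) (v : ℕ) : ℕ :=
  W (1 + n + v) + (W (1 + n + n + v) + A 3 v)

/-- The kept positions in increasing order. -/
def keptPos (W : ℕ → ℕ) (n : ℕ) (A : Arrays) : List ℕ :=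
  (List.range n).filter fun v => keepVal W n A v ≠ 0

/-- Up to the arrays `1` and `2`, `A` agrees with `A₀`, and the output so far is `w`. -/
structure Written (A₀ : Arrays) (c : ℕ) (A : Arrays) (w : List ℕ) : Prop where
  frame : ∀ a, a ≠ 1 → a ≠ 2 → A a = A₀ a
  count : A 2 1 = c
  output : (List.range (A 2 0)).map (A 1) = w

theorem Written.append {A₀ A : Arrays} {c : ℕ} {w : List ℕ} (h : Written A₀ c A w) {e : Expr}
    {k x : ℕ} {env : ℕ → ℕ} (he : e.eval env A = x) :
    Written A₀ c ((append e).sem k env A) (w ++ [x]) := by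
  refine ⟨fun a h1 h2 => ?_, ?_, ?_⟩
  · rw [← h.frame a h1 h2]
    simp [Kernel.append, Stmt.sem, Arrays.set, h1, h2]
  · rw [← h.count]
    simp [Kernel.append, Stmt.sem, Arrays.set, eval]
  · have h1 : (Kernel.append e).sem k env A 2 0 = A 2 0 + 1 := by
      simp [Kernel.append, Stmt.sem, Arrays.set, eval]
    have h2 : (Kernel.append e).sem k env A 1 = Function.update (A 1) (A 2 0) x := by
      simp [Kernel.append, Stmt.sem, Arrays.set, eval, he]
    rw [h1, h2, List.range_succ, List.map_append, ← h.output]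
    congr 1
    · refine List.map_congr_left fun i hi => ?_
      rw [Function.update_of_ne (List.mem_range.mp hi).ne]
    · simp

section

variable {W : ℕ → ℕ} {n : ℕ} {A₀ A : Arrays}

theorem keep_eval (hA : A 0 = W) (hn : W 0 = n) {env : ℕ → ℕ} {k v : ℕ} (hv : env k = v) :
    (keep (var k)).eval env A = keepVal W n A v := by
  simp [keep, keepVal, bflag, sflag, Kernel.num, eval, hA, hn, hv]

/-- Whether a position is kept depends only on the arrays `0` and `3`, which are not altered while
writing, so the list computed from `A₀` remains the right one. -/
theorem Written.rep_keep {c : ℕ} (h0 : A₀ 0 = W) (hn : W 0 = n) {P : Stmt} {k : ℕ} {env : ℕ → ℕ}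
    {g : ℕ → List ℕ} (hP : ∀ A w, Written A₀ c A w → ∀ v < n,
      Written A₀ c (P.sem (k + 1) (Function.update env k v) A) (w ++ g v))
    {w : List ℕ} (h : Written A₀ c A w) :
    Written A₀ c (Stmt.sem (.rep 0 (.ite (keep (var k)) P)) k env A)
      (w ++ (keptPos W n A₀).flatMap g) := by
  have hA0 {A : Arrays} {w : List ℕ} (h : Written A₀ c A w) : A 0 = W := by
    rw [h.frame 0 (by norm_num) (by norm_num), h0]
  rw [Stmt.sem, hA0 h, hn, add_zero, keptPos]
  refine iter_induction (fun m A => Written A₀ c A (w ++ ((List.range m).filter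
    fun v => keepVal W n A₀ v ≠ 0).flatMap g)) (by simpa using h) ?_
  intro v hv A' hA'
  have hk : (keep (var k)).eval (Function.update env k v) A' = keepVal W n A₀ v := by
    rw [keep_eval (hA0 hA') hn (v := v) (by simp), keepVal,
      hA'.frame 3 (by norm_num) (by norm_num), keepVal]
  rw [Stmt.sem, hk, List.range_succ, List.filter_append, List.flatMap_append, ← List.append_assoc]
  by_cases hv0 : keepVal W n A₀ v = 0
  · simpa [hv0] using hA'
  · simpa [hv0] using hP A' _ hA' v hv

theorem Written.column {c : ℕ} (h0 : A₀ 0 = W) (hn : W 0 = n) {e : Expr} {env : ℕ → ℕ}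
    {f : ℕ → ℕ} (he : ∀ A, A 0 = W → ∀ v < n, e.eval (Function.update env 0 v) A = f v)
    {w : List ℕ} (h : Written A₀ c A w) :
    Written A₀ c ((column e).sem 0 env A) (w ++ (keptPos W n A₀).map f) := by
  rw [List.map_eq_flatMap]
  refine Written.rep_keep h0 hn (fun A w hA v hv => hA.append (he A ?_ v hv)) h
  rw [hA.frame 0 (by norm_num) (by norm_num), h0]

theorem Written.matrix {c : ℕ} (hA₀ : Ready W n A₀) {env : ℕ → ℕ}
    {w : List ℕ} (h : Written A₀ c A w) :
    Written A₀ c (matrix.sem 0 env A) (w ++ (keptPos W n A₀).flatMap fun u =>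
      (keptPos W n A₀).map fun v => W (1 + n + n + n + u * n + v)) := by
  refine Written.rep_keep hA₀.input hA₀.num (fun A w hA u hu => ?_) h
  rw [List.map_eq_flatMap]
  refine Written.rep_keep hA₀.input hA₀.num (fun A w hA v hv => hA.append ?_) hA
  have h1 : A 0 = W := by rw [hA.frame 0 (by norm_num) (by norm_num), hA₀.input]
  have h2 : A 6 u = 1 + n + n + n + u * n := by
    rw [hA.frame 6 (by norm_num) (by norm_num), hA₀.row u hu]
  simp [eval, entry, h1, h2]

theorem count_sem (h0 : A₀ 0 = W) (hn : W 0 = n) (h2 : A₀ 2 = 0) (env : ℕ → ℕ) :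
    Written A₀ (keptPos W n A₀).length (count.sem 0 env A₀) [] := by
  have key : (∀ a, a ≠ 2 → count.sem 0 env A₀ a = A₀ a) ∧ count.sem 0 env A₀ 2 0 = 0 ∧
      count.sem 0 env A₀ 2 1 = (keptPos W n A₀).length := by
    rw [count, Stmt.sem, h0, hn, add_zero, keptPos]
    refine iter_induction (fun m (A : Arrays) => (∀ a, a ≠ 2 → A a = A₀ a) ∧ A 2 0 = 0 ∧
      A 2 1 = ((List.range m).filter fun v => keepVal W n A₀ v ≠ 0).length) (by simp [h2]) ?_
    rintro v - A ⟨g1, g2, g3⟩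
    have hk : (keep (var 0)).eval (Function.update env 0 v) A = keepVal W n A₀ v := by
      rw [keep_eval (by rw [g1 0 (by norm_num), h0]) hn (v := v) (by simp), keepVal,
        g1 3 (by norm_num), keepVal]
    rw [Stmt.sem, hk, List.range_succ, List.filter_append, List.length_append]
    by_cases hv0 : keepVal W n A₀ v = 0
    · refine ⟨by simpa [hv0] using g1, by simpa [hv0] using g2, ?_⟩
      simpa [hv0] using g3
    · rw [if_pos hv0]
      refine ⟨fun a ha => ?_, ?_, ?_⟩
      · simp [Stmt.sem, Arrays.set, ha, g1 a ha]
      · simp [Stmt.sem, Arrays.set, eval, g2]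
      · simp [Stmt.sem, Arrays.set, eval, g3, hv0]
  exact ⟨fun a _ ha => key.1 a ha, key.2.2, by simp [key.2.1]⟩

theorem emit_sem (hA₀ : Ready W n A₀) (h2 : A₀ 2 = 0) (env : ℕ → ℕ) :
    Written A₀ (keptPos W n A₀).length (emit.sem 0 env (count.sem 0 env A₀))
      ([0, 0] ++ (keptPos W n A₀).length :: ((keptPos W n A₀).map (fun v => W (1 + v)) ++
        (keptPos W n A₀).map (fun v => W (1 + n + v)) ++
        (keptPos W n A₀).map (fun v => W (1 + n + n + v)) ++
        (keptPos W n A₀).flatMap fun u => (keptPos W n A₀).map fun v =>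
          W (1 + n + n + n + u * n + v))) := by
  have s1 := ((count_sem hA₀.input hA₀.num h2 env).append (e := const 0) (x := 0) (k := 0)
    (env := env) rfl).append (e := const 0) (x := 0) (k := 0) (env := env) rfl
  have s2 := s1.append (e := load 2 (const 1)) (k := 0) (env := env) s1.count
  have s3 := s2.column hA₀.input hA₀.num (e := load 0 (add (const 1) (var 0))) (env := env)
    (f := fun v => W (1 + v)) (fun A hA v _ => by simp [eval, hA])
  have s4 := s3.column hA₀.input hA₀.num (e := bflag (var 0)) (env := env)
    (f := fun v => W (1 + n + v)) (fun A hA v _ => by simp [eval, bflag, Kernel.num, hA, hA₀.num])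
  have s5 := s4.column hA₀.input hA₀.num (e := sflag (var 0)) (env := env)
    (f := fun v => W (1 + n + n + v))
    (fun A hA v _ => by simp [eval, sflag, Kernel.num, hA, hA₀.num])
  have s6 := s5.matrix hA₀ (env := env)
  simpa only [emit, Stmt.sem, List.nil_append, List.cons_append, List.append_assoc] using s6

end

/-! ### Reading the input -/

theorem getD_flatMap {n : ℕ} {f : ℕ → List ℕ} {l : List ℕ} (hf : ∀ u, (f u).length = n) {i j : ℕ}
    (hi : i < l.length) (hj : j < n) :
    (l.flatMap f).getD (i * n + j) 0 = (f (l.getD i 0)).getD j 0 := by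
  induction l generalizing i with
  | nil => simp at hi
  | cons a l ih =>
    rw [List.flatMap_cons]
    cases i with
    | zero =>
      rw [List.getD_append _ _ _ _ (by rw [hf]; omega)]
      simp
    | succ i =>
      have h1 : (i + 1) * n + j = n + (i * n + j) := by ring
      rw [h1, List.getD_append_right _ _ _ _ (by rw [hf]; omega), hf, Nat.add_sub_cancel_left,
        ih (by simpa using hi)]
      simp

section

variable {G : FinGraph ℕ} {B S : Finset ℕ} {l : List ℕ}

theorem getD_map {f : ℕ → ℕ} {i : ℕ} (hi : i < l.length) :
    (l.map f).getD i 0 = f (l.getD i 0) := by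
  rw [List.getD_eq_getElem _ _ hi, List.getD_eq_getElem _ _ (by simpa using hi), List.getElem_map]

theorem encodeWith_length_le : l.length + 1 ≤ (encodeWith l G B S).length := by
  simp [encodeWith]

theorem encodeWith_zero : (encodeWith l G B S).getD 0 0 = l.length := by
  simp [encodeWith]

theorem encodeWith_name {i : ℕ} (hi : i < l.length) :
    (encodeWith l G B S).getD (1 + i) 0 = l.getD i 0 := by
  rw [encodeWith, Nat.add_comm, List.getD_cons_succ, List.append_assoc, List.append_assoc,
    List.getD_append _ _ _ _ hi]

open Classical in
theorem encodeWith_bflag {i : ℕ} (hi : i < l.length) :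
    (encodeWith l G B S).getD (1 + l.length + i) 0 = if l.getD i 0 ∈ B then 1 else 0 := by
  rw [encodeWith, show 1 + l.length + i = l.length + i + 1 by omega, List.getD_cons_succ,
    List.append_assoc, List.append_assoc, List.getD_append_right _ _ _ _ (by omega),
    List.getD_append _ _ _ _ (by simpa using hi), Nat.add_sub_cancel_left, getD_map hi]

open Classical in
theorem encodeWith_sflag {i : ℕ} (hi : i < l.length) :
    (encodeWith l G B S).getD (1 + l.length + l.length + i) 0 =
      if l.getD i 0 ∈ S then 1 else 0 := by
  rw [encodeWith, show 1 + l.length + l.length + i = l.length + (l.length + i) + 1 by omega,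
    List.getD_cons_succ, List.append_assoc, List.append_assoc,
    List.getD_append_right _ _ _ _ (by omega), Nat.add_sub_cancel_left,
    List.getD_append_right _ _ _ _ (by simp), List.length_map, Nat.add_sub_cancel_left,
    List.getD_append _ _ _ _ (by simpa using hi), getD_map hi]

open Classical in
theorem encodeWith_adj {i j : ℕ} (hi : i < l.length) (hj : j < l.length) :
    (encodeWith l G B S).getD (1 + l.length + l.length + l.length + i * l.length + j) 0 =
      if G.graph.Adj (l.getD i 0) (l.getD j 0) then 1 else 0 := by
  rw [encodeWith, show 1 + l.length + l.length + l.length + i * l.length + j =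
      l.length + (l.length + (l.length + (i * l.length + j))) + 1 by ring,
    List.getD_cons_succ, List.append_assoc, List.append_assoc,
    List.getD_append_right _ _ _ _ (by omega), Nat.add_sub_cancel_left,
    List.getD_append_right _ _ _ _ (by simp), List.length_map, Nat.add_sub_cancel_left,
    List.getD_append_right _ _ _ _ (by simp), List.length_map, Nat.add_sub_cancel_left,
    getD_flatMap (by simp) hi hj, getD_map hj]

theorem getD_idxOf {u : ℕ} (hu : u ∈ l) : l.getD (l.idxOf u) 0 = u := by
  rw [List.getD_eq_getElem _ _ (List.idxOf_lt_length_iff.mpr hu)]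
  simp

theorem idxOf_getD (hl : l.Nodup) {i : ℕ} (hi : i < l.length) : l.idxOf (l.getD i 0) = i := by
  rw [List.getD_eq_getElem _ _ hi]
  exact hl.idxOf_getElem i hi

theorem admissible_iff {W : ℕ → ℕ} (hW : ∀ i, W i = (encodeWith l G B S).getD i 0) {x y v : ℕ}
    (hx : x < l.length) (hy : y < l.length) (hv : v < l.length) :
    Admissible W l.length (1 + l.length + l.length + l.length + x * l.length + y) v ↔
      l.getD x 0 ∈ S ∧ l.getD y 0 ∈ S ∧ l.getD v 0 ∉ B ∧ l.getD v 0 ∉ S ∧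
        G.graph.Adj (l.getD x 0) (l.getD v 0) ∧ G.graph.Adj (l.getD y 0) (l.getD v 0) := by
  have key : ∀ x < l.length, ∀ y < l.length, (W (1 + l.length + l.length + x) ≠ 0 ∧
      W (1 + l.length + l.length + y) ≠ 0 ∧ W (1 + l.length + v) = 0 ∧
      W (1 + l.length + l.length + v) = 0 ∧
      W (1 + l.length + l.length + l.length + x * l.length + v) ≠ 0 ∧
      W (1 + l.length + l.length + l.length + y * l.length + v) ≠ 0) ↔
      l.getD x 0 ∈ S ∧ l.getD y 0 ∈ S ∧ l.getD v 0 ∉ B ∧ l.getD v 0 ∉ S ∧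
        G.graph.Adj (l.getD x 0) (l.getD v 0) ∧ G.graph.Adj (l.getD y 0) (l.getD v 0) := by
    intro x hx y hy
    rw [hW, hW, hW, hW, hW, hW, encodeWith_sflag hx, encodeWith_sflag hy, encodeWith_bflag hv,
      encodeWith_sflag hv, encodeWith_adj hx hv, encodeWith_adj hy hv]
    simp
  rw [← key x hx y hy]
  constructor
  · rintro ⟨x', hx', y', hy', h, -, h'⟩
    obtain ⟨rfl, rfl⟩ := pair_injective (x := x) (x' := x') hy hy' (by omega)
    exact h'
  · intro h
    exact ⟨x, hx, y, hy, rfl, hv, h⟩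

/-- The labeling of the graph read off from the final arrays. -/
def labeling (hl : l.Nodup) (hlG : l.toFinset = G.verts) (hS : S ⊆ G.verts) {W : ℕ → ℕ}
    (hW : ∀ i, W i = (encodeWith l G B S).getD i 0) {A₀ A : Arrays}
    (hA : Inv (Admissible W l.length) (l.length + 1) A₀ A) (hst : Stable W l.length A) :
    G.Labeling B S (l.length + 1) where
  d u := A 3 (l.idxOf u)
  -- Partners are stored increased by one; owners are row-major indices of pairs, shifted by the
  -- offset of the matrix.
  μ x y := l.getD (A 5 (1 + l.length + l.length + l.length + l.idxOf x * l.length + l.idxOf y) - 1) 0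
  own u := (l.getD ((A 4 (l.idxOf u) - (1 + l.length + l.length + l.length)) / l.length) 0,
    l.getD ((A 4 (l.idxOf u) - (1 + l.length + l.length + l.length)) % l.length) 0)
  own_mem := by
    intro u hu _ _ hd
    have hul : u ∈ l := by rwa [← List.mem_toFinset, hlG]
    have hun : l.idxOf u < l.length := List.idxOf_lt_length_iff.mpr hul
    obtain ⟨h1, h2⟩ := hA.own_spec _ hd
    obtain ⟨x, hx, y, hy, hxy, -⟩ := id h1
    rw [hxy] at h1 h2
    rw [admissible_iff hW hx hy hun] at h1
    have hsub : A 4 (l.idxOf u) - (1 + l.length + l.length + l.length) = y + l.length * x := by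
      rw [hxy, Nat.mul_comm]
      omega
    have hn : 0 < l.length := by omega
    rw [hsub, Nat.add_mul_div_left _ _ hn, Nat.div_eq_of_lt hy, Nat.zero_add, Nat.add_mul_mod_self_left,
      Nat.mod_eq_of_lt hy]
    refine ⟨h1.1, h1.2.1, ?_⟩
    dsimp only
    rw [idxOf_getD hl hx, idxOf_getD hl hy, h2, Nat.add_sub_cancel, getD_idxOf hul]
  μ_spec := by
    intro x hxS y hyS u hu huB huS hxu hyu hd
    have hmem {u : ℕ} (hu : u ∈ G.verts) : u ∈ l := by rwa [← List.mem_toFinset, hlG]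
    have hlt {u : ℕ} (hu : u ∈ G.verts) : l.idxOf u < l.length :=
      List.idxOf_lt_length_iff.mpr (hmem hu)
    have hx := hlt (hS hxS)
    have hy := hlt (hS hyS)
    have gx := getD_idxOf (hmem (hS hxS))
    have gy := getD_idxOf (hmem (hS hyS))
    have hadm : Admissible W l.length
        (1 + l.length + l.length + l.length + l.idxOf x * l.length + l.idxOf y) (l.idxOf u) := by
      rw [admissible_iff hW hx hy (hlt hu), gx, gy, getD_idxOf (hmem hu)]
      exact ⟨hxS, hyS, huB, huS, hxu, hyu⟩
    -- In a stable state, an unmatched pair would force the label of `u` up to `l.length + 1`.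
    have h5 : A 5 (1 + l.length + l.length + l.length + l.idxOf x * l.length + l.idxOf y) ≠ 0 :=
      fun h => absurd (hst _ hx _ hy h _ hadm) (by omega)
    obtain ⟨v, hv1, hv2, hv3⟩ := hA.partner_spec _ (by omega) h5
    have hv4 := (hA.own_spec v hv2).1
    have hvn := (hv4.ne_zero_and_lt).2
    have hle := hA.label_le_label v (l.idxOf u) hv2 (by rwa [hv3])
    rw [hv3, admissible_iff hW hx hy hvn, gx, gy] at hv4
    obtain ⟨-, -, hvB, hvS, hxv, hyv⟩ := hv4
    rw [hv1, Nat.add_sub_cancel, idxOf_getD hl hvn, hv3]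
    refine ⟨G.mem_of_adj _ _ hxv.symm, hvB, hvS, hv2, hxv, hyv, hle, ?_⟩
    have hsub : 1 + l.length + l.length + l.length + l.idxOf x * l.length + l.idxOf y -
        (1 + l.length + l.length + l.length) = l.idxOf y + l.length * l.idxOf x := by
      rw [Nat.mul_comm]
      omega
    have hn : 0 < l.length := by omega
    rw [hsub, Nat.add_mul_div_left _ _ hn, Nat.div_eq_of_lt hy, Nat.zero_add,
      Nat.add_mul_mod_self_left, Nat.mod_eq_of_lt hy, gx, gy]

end

/-! ### The kernelization -/

theorem eval_le_eval (p : Polynomial ℕ) {m n : ℕ} (h : m ≤ n) : p.eval m ≤ p.eval n := by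
  rw [Polynomial.eval_eq_sum_range, Polynomial.eval_eq_sum_range]
  exact Finset.sum_le_sum fun i _ => Nat.mul_le_mul_left _ (Nat.pow_le_pow_left h i)

theorem length_le_wordSize (w : List ℕ) : w.length ≤ RAM.wordSize w := by
  simp [RAM.wordSize]

/-- The whole computation except for the length of the output. -/
def main : Stmt := .seq rows (.seq auction (.seq count emit))

/-- The kernelization: finally, the length of the output is copied to register `0`. -/
def program : RAM.Program := .seq (main.compile 0) (.seq (.const 0 0) (.load 0 2 0))

theorem main_scoped : main.Scoped 0 := by
  simp [main, rows, auction, round, bidStmt, obstruction, count, emit, column, matrix, append, keep,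
    bflag, sflag, entry, Kernel.num, Stmt.Scoped, Expr.Scoped]

theorem main_sem {G : FinGraph ℕ} {B S : Finset ℕ} {l : List ℕ} (hl : l.Nodup)
    (hlG : l.toFinset = G.verts) (hS : S ⊆ G.verts) {A : Arrays}
    (hA0 : ∀ i, A 0 i = (encodeWith l G B S).getD i 0) (hA : ∀ a ≠ 0, A a = 0) (env : ℕ → ℕ) :
    ∃ (F : G.Labeling B S (l.length + 1)) (l' : List ℕ), l'.Nodup ∧
      l'.toFinset = (G.restrict F.kept).verts ∧
      (List.range (main.sem 0 env A 2 0)).map (main.sem 0 env A 1) =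
        encodeInt 0 ++ encodeWith l' (G.restrict F.kept) B S := by
  classical
  have hn : A 0 0 = l.length := by rw [hA0, encodeWith_zero]
  obtain ⟨hr1, hr2⟩ := rows_sem A env
  rw [hn] at hr1
  obtain ⟨A₁, hA₁⟩ : ∃ A₁, A₁ = rows.sem 0 env A := ⟨_, rfl⟩
  rw [← hA₁] at hr1 hr2
  have hz (a : ℕ) (h0 : a ≠ 0) (h6 : a ≠ 6) : A₁ a = 0 := by rw [hr2 a h6, hA a h0]
  -- With all labels, owners and partners zero, the invariant is trivial.
  have hinv : Inv (Admissible (A 0) l.length) (l.length + 1) A₁ A₁ := by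
    have h3 := hz 3 (by norm_num) (by norm_num)
    have h4 := hz 4 (by norm_num) (by norm_num)
    have h5 := hz 5 (by norm_num) (by norm_num)
    constructor <;> simp [h3, h4, h5]
  obtain ⟨hI, hst⟩ := auction_sem hr1 hinv env
  obtain ⟨A₂, hA₂'⟩ : ∃ A₂, A₂ = auction.sem 0 env A₁ := ⟨_, rfl⟩
  rw [← hA₂'] at hI hst
  have hA₂ : Ready (A 0) l.length A₂ := hr1.of_inv hI
  have h2 : A₂ 2 = 0 := by
    rw [hI.frame 2 (by norm_num) (by norm_num) (by norm_num), hz 2 (by norm_num) (by norm_num)]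
  obtain ⟨F, hF⟩ : ∃ F : G.Labeling B S (l.length + 1), ∀ u, F.d u = A₂ 3 (l.idxOf u) :=
    ⟨labeling hl hlG hS hA0 hI hst, fun _ => rfl⟩
  have hkept : F.kept ⊆ G.verts := Finset.filter_subset _ _
  set I := keptPos (A 0) l.length A₂ with hIdef
  have hmemI (i : ℕ) : i ∈ I ↔ i < l.length ∧ l.getD i 0 ∈ F.kept := by
    rw [hIdef, keptPos, List.mem_filter, List.mem_range]
    refine and_congr_right fun hi => ?_
    have hv : l.getD i 0 ∈ G.verts := by
      rw [← hlG, List.mem_toFinset, List.getD_eq_getElem _ _ hi]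
      exact List.getElem_mem hi
    have hd : F.d (l.getD i 0) = A₂ 3 i := by rw [hF, idxOf_getD hl hi]
    rw [FinGraph.Labeling.kept, Finset.mem_filter, hd, keepVal, hA0, hA0, encodeWith_bflag hi,
      encodeWith_sflag hi]
    simp
    tauto
  refine ⟨F, I.map fun i => l.getD i 0, ?_, ?_, ?_⟩
  · refine List.Nodup.map_on ?_ (List.nodup_range.filter _)
    intro i hi j hj hij
    rw [← idxOf_getD hl ((hmemI i).mp hi).1, hij, idxOf_getD hl ((hmemI j).mp hj).1]
  · rw [FinGraph.restrict_verts hkept]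
    ext u
    simp only [List.mem_toFinset, List.mem_map]
    constructor
    · rintro ⟨i, hi, rfl⟩
      exact ((hmemI i).mp hi).2
    · intro hu
      have hul : u ∈ l := by
        rw [← List.mem_toFinset, hlG]
        exact hkept hu
      refine ⟨l.idxOf u, (hmemI _).mpr ⟨List.idxOf_lt_length_iff.mpr hul, ?_⟩, getD_idxOf hul⟩
      rwa [getD_idxOf hul]
  · have hout := (emit_sem hA₂ h2 env).output
    have hmain : main.sem 0 env A = emit.sem 0 env (count.sem 0 env A₂) := by
      simp only [main, Stmt.sem, ← hA₁, ← hA₂']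
    rw [hmain, hout, ← hIdef]
    have e1 : I.map (fun v => A 0 (1 + v)) = I.map fun i => l.getD i 0 :=
      List.map_congr_left fun i hi => by rw [hA0, encodeWith_name ((hmemI i).mp hi).1]
    have e2 : I.map (fun v => A 0 (1 + l.length + v)) =
        I.map fun i => if l.getD i 0 ∈ B then 1 else 0 :=
      List.map_congr_left fun i hi => by rw [hA0, encodeWith_bflag ((hmemI i).mp hi).1]
    have e3 : I.map (fun v => A 0 (1 + l.length + l.length + v)) =
        I.map fun i => if l.getD i 0 ∈ S then 1 else 0 :=
      List.map_congr_left fun i hi => by rw [hA0, encodeWith_sflag ((hmemI i).mp hi).1]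
    have e4 : (I.flatMap fun u => I.map fun v =>
        A 0 (1 + l.length + l.length + l.length + u * l.length + v)) =
        I.flatMap fun i => I.map fun j =>
          if (G.restrict F.kept).graph.Adj (l.getD i 0) (l.getD j 0) then 1 else 0 := by
      refine List.flatMap_congr fun i hi => List.map_congr_left fun j hj => ?_
      have hi := (hmemI i).mp hi
      have hj := (hmemI j).mp hj
      rw [hA0, encodeWith_adj hi.1 hj.1]
      simp only [FinGraph.restrict, hi.2, hj.2, and_true]
    rw [e1, e2, e3, e4]
    simp [encodeWith, encodeInt, List.map_map, List.flatMap_map, Function.comp_def]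

theorem isBoundariedKernelization : IsBoundariedKernelization FinGraph.longCycleOpt
    FinGraph.IsVertexCover (fun n => (2 * Polynomial.X ^ 2 + (2 * Polynomial.X ^ 2) ^ 2 :
      Polynomial ℕ).eval n) (fun n => 2 * n ^ 2) program := by
  -- The two extra steps copy the output length to register `0`.
  refine ⟨main.time + 2, fun G B S hB hS w hw => ?_⟩
  obtain ⟨l, hl, hlG, rfl⟩ := hw
  set s₀ := RAM.State.init (encodeWith l G B S) with hs₀
  obtain ⟨t, s, hex, ht, harr, -⟩ := main.exec_compile 0 0 s₀ main_scoped (by simp)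
  obtain ⟨F, l', hl', hlG', hout⟩ := main_sem (A := s₀.arr) hl hlG hS.1 (fun i => rfl)
    (fun a ha => by funext i; exact if_neg ha) 0
  have hcard : F.kept.card ≤ 2 * (B.card + S.card) ^ 2 := F.card_kept_le
  have hkept : F.kept ⊆ G.verts := Finset.filter_subset _ _
  have hBk : B ⊆ F.kept := fun u hu => Finset.mem_filter.mpr ⟨hB hu, Or.inl hu⟩
  have hSk : S ⊆ F.kept := fun u hu => Finset.mem_filter.mpr ⟨hS.1 hu, Or.inr (Or.inl hu)⟩
  have hverts := FinGraph.restrict_verts hkept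
  have hsize := (G.restrict F.kept).size_le
  rw [hverts] at hsize
  have hf : F.kept.card + F.kept.card ^ 2 ≤ (2 * Polynomial.X ^ 2 + (2 * Polynomial.X ^ 2) ^ 2 :
      Polynomial ℕ).eval (B.card + S.card) := by
    simp only [Polynomial.eval_add, Polynomial.eval_mul, Polynomial.eval_pow, Polynomial.eval_X,
      Polynomial.eval_ofNat]
    exact Nat.add_le_add hcard (Nat.pow_le_pow_left hcard 2)
  -- The label bound `n + 1` exceeds `|S|` because the cover consists of vertices of `G`.
  have hlen : S.card < l.length + 1 := by
    have := Finset.card_le_card hS.1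
    rw [← hlG, List.toFinset_card_of_nodup hl] at this
    omega
  refine ⟨_, _, G.restrict F.kept, S, 0, encodeWith l' (G.restrict F.kept) B S,
    .seq hex (.seq (.const ..) (.load ..)), ?_, ?_, ⟨l', hl', hlG', rfl⟩, ?_, hS.restrict hSk,
    hsize.trans hf, ?_, ?_, F.gluingEquiv hB hS hlen⟩
  · have h0 : s₀.arr 0 0 = l.length := encodeWith_zero (G := G) (B := B) (S := S)
    rw [h0] at ht
    have h1 : l.length ≤ RAM.wordSize (encodeWith l G B S) :=
      (Nat.le_of_succ_le encodeWith_length_le).trans (length_le_wordSize _)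
    have h2 := eval_le_eval main.time h1
    simp only [Polynomial.eval_add, Polynomial.eval_ofNat]
    omega
  · rw [← hout, ← harr]
    simp [RAM.State.output, RAM.State.setReg]
  · rwa [hverts]
  · have := Finset.card_le_card hSk
    exact (this.trans (Nat.le_add_right _ _)).trans hf
  · rwa [hverts]

end Kernel

/-- Long Cycle parameterized by the size of a given vertex cover has a polynomial boundaried
kernelization with `O((|B| + k)²)` vertices. -/
theorem mainTheorem6 :
    ∃ (P : RAM.Program) (f : Polynomial ℕ) (c : ℕ),
      IsBoundariedKernelization FinGraph.longCycleOpt FinGraph.IsVertexCover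
        (fun n => f.eval n) (fun n => c * n ^ 2) P :=
  ⟨Kernel.program, _, 2, Kernel.isBoundariedKernelization⟩
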